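/- Let $q,\mathfrak b\ge 0$, let $\nu$ be a measure on $(0,\infty)$ with $\int_0^\infty\min\{1,y\}\,\nu(dy)<\infty$, and put, for $\Re z\ge 0$, $$\Phi(z)=q+\mathfrak b z+\int_{(0,\infty)}(1-e^{-zy})\,\nu(dy),\qquad \Phi^\dagger(z)=\Phi(z)-q-\mathfrak b z .$$ Let $\sigma=(\sigma(x))_{x\ge 0}$ be a potentially killed subordinator with killing rate $q$ and Laplace exponent $\Phi$: $\sigma$ coincides with a conservative subordinator before an independent exponential time of parameter $q$ (equal to $\infty$ if $q=0$), it equals $\infty$ from that time on, and $\mathbb E[e^{-z\sigma(1)}]=e^{-\Phi(z)}$ for $\Re z\ge0$, with $e^{-z\infty}=0$. With $\bar\nu(s)=\nu((s,\infty))$ and $t/0=\infty$, let $$\mathbb D=\{(x,t): t>0,\ 0<x<t/\mathfrak b\},\qquad f_\Phi(x,t)=\int_{[0,t]}\bar\nu(t-y)\,\mathbb P(\sigma(x)\in dy)\ \text{ on }\mathbb D,$$ and $f_\Phi=0$ outside $\mathbb D$. Let $\Delta(x)=\int_{(0,1/x]}y^2\,\nu(dy)$ for $x>0$. **Theorem.**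 There are numbers $x_0(n,L)\ge 0$, for integers $n\ge0$ and $L\in(0,\infty]$, depending only on $n$ and $L$, with $x_0(n,\infty)=0$ for every $n$, such that the following holds. Suppose that $$\liminf_{x\to\infty}\frac{x^2\Delta(x)}{\ln x}=L\in(0,\infty].$$ Then for all integers $n,k,l\ge0$ with $k+l\le n$ and all $(x,t)\in\mathbb D$ with $x>x_0(n,L)$, the integral defining $f_\Phi(x,t)$ is finite, and the mixed partial derivatives of $f_\Phi$ at $(x,t)$ of order $k$ in $x$ and order $l$ in $t$ exist, whatever the order in which the $k+l$ differentiations are carried out. All of them are given, for every $a>0$, by $$\frac{(-1)^k}{2\pi}\int_{-\infty}^{\infty}\frac{\Phi^\dagger(a+ib)\,\Phi(a+ib)^k}{(a+ib)^{1-l}}\,e^{t(a+ib)-x\Phi(a+ib)}\,db ,$$ where the integral is absolutely convergent. -/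

import Mathlib

open MeasureTheory ProbabilityTheory Filter Set
open scoped ENNReal NNReal Topology

noncomputable section

namespace KilledSub

/-- The characteristics of a potentially killed subordinator: the killing rate `q ≥ 0`, the
drift `𝔟 ≥ 0` and the Lévy measure `ν` on `(0, ∞)`, with `∫ min (y, 1) ν(dy) < ∞`. -/
structure Characteristics where
  q : ℝ
  drift : ℝ
  levy : Measure ℝ
  q_nonneg : 0 ≤ q
  drift_nonneg : 0 ≤ drift
  levy_Iic : levy (Iic 0) = 0
  lintegral_min_lt_top : ∫⁻ y, ENNReal.ofReal (min y 1) ∂levy < ⊤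

namespace Characteristics

variable (T : Characteristics)

/-- The Bernstein function `Φ(z) = q + 𝔟 z + ∫ (1 - e^{-zy}) ν(dy)`, for `Re z ≥ 0`. -/
def Phi (z : ℂ) : ℂ :=
  T.q + T.drift * z + ∫ y : ℝ in Ioi 0, (1 - Complex.exp (-z * y)) ∂T.levy

/-- `Φ†(z) = Φ(z) - q - 𝔟 z`. -/
def PhiDag (z : ℂ) : ℂ := T.Phi z - T.q - T.drift * z

/-- The tail `ν̄(s) = ν((s, ∞))` of the Lévy measure (infinite at `0` if `ν` is infinite). -/
def tail (s : ℝ) : ℝ≥0∞ := T.levy (Ioi s)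

/-- The truncated second moment `Δ(x) = ∫_{(0, 1/x]} y² ν(dy)`, `x > 0`. -/
def Delta (x : ℝ) : ℝ := ∫ y in Ioc 0 (1 / x), y ^ 2 ∂T.levy

/-- The condition `liminf_{x → ∞} x² Δ(x) / ln x = L ∈ (0, ∞]`. The ratio is nonnegative as soon as
`x > 1`, so that the lower limit can be taken in `[0, ∞]`. -/
def GrowthCondition (L : ℝ≥0∞) : Prop :=
  0 < L ∧
    liminf (fun x : ℝ => ENNReal.ofReal (x ^ 2 * T.Delta x / Real.log x)) atTop = L

/-- The domain `𝔻 = {t > 0, 0 < x < t / 𝔟}` with `t / 0 = ∞`, as a set of pairs `(x, t)`. -/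
def domain : Set (ℝ × ℝ) := {p | 0 < p.2 ∧ 0 < p.1 ∧ T.drift * p.1 < p.2}

end Characteristics

section Processes

variable {Ω : Type*} [MeasurableSpace Ω]

/-- A conservative subordinator on a probability space: a process started at `0` with independent
and stationary increments, whose paths are almost surely non-decreasing and right-continuous
(left limits then exist by monotonicity). -/
structure IsSubordinator (S : ℝ≥0 → Ω → ℝ) (P : Measure Ω) : Prop where
  measurable : ∀ x, Measurable (S x)
  zero : ∀ᵐ ω ∂P, S 0 ω = 0
  mono : ∀ᵐ ω ∂P, Monotone (fun x => S x ω)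
  rightCont : ∀ᵐ ω ∂P, ∀ x, ContinuousWithinAt (fun u => S u ω) (Ici x) x
  indep : HasIndepIncrements S P
  stationary : ∀ x h : ℝ≥0, IdentDistrib (fun ω => S (x + h) ω - S x ω) (S h) P P

/-- `σ` is a potentially killed subordinator with killing rate `q`: it agrees with a conservative
subordinator `S` before an independent exponential time `e` of parameter `q` (`e = ∞` almost surely
if `q = 0`) and equals `∞` from `e` on. The law of `e` is given by `P(e > s) = e^{-qs}`. -/
def IsKilledSubordinator (q : ℝ) (σ : ℝ≥0 → Ω → ℝ≥0∞) (P : Measure Ω) : Prop :=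
  ∃ (S : ℝ≥0 → Ω → ℝ) (e : Ω → ℝ≥0∞),
    IsSubordinator S P ∧ Measurable e ∧
    (∀ s : ℝ≥0, P {ω | (s : ℝ≥0∞) < e ω} = ENNReal.ofReal (Real.exp (-q * s))) ∧
    IndepFun (fun ω (x : ℝ≥0) => S x ω) e P ∧
    ∀ (x : ℝ≥0) (ω : Ω), ((x : ℝ≥0∞) < e ω → σ x ω = ENNReal.ofReal (S x ω)) ∧ (e ω ≤ x → σ x ω = ⊤)

/-- `Φ` is the Laplace exponent of `σ`: `E[e^{-z σ(1)}] = e^{-Φ(z)}` for `Re z ≥ 0`, where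
`e^{-z ∞} = 0`. -/
def HasLaplaceExponent (σ : ℝ≥0 → Ω → ℝ≥0∞) (P : Measure Ω) (Φ : ℂ → ℂ) : Prop :=
  ∀ z : ℂ, 0 ≤ z.re →
    ∫ ω in {ω | σ 1 ω ≠ ⊤}, Complex.exp (-z * ((σ 1 ω).toReal : ℂ)) ∂P = Complex.exp (-Φ z)

/-- The integral `∫_{[0, t]} ν̄(t - y) P(σ(x) ∈ dy)`, with values in `[0, ∞]`. -/
def densityIntegral (T : Characteristics) (σ : ℝ≥0 → Ω → ℝ≥0∞) (P : Measure Ω) (x t : ℝ) : ℝ≥0∞ :=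
  ∫⁻ y in Iic (ENNReal.ofReal t), T.tail (t - y.toReal) ∂(P.map (σ x.toNNReal))

open Classical in
/-- The function `f_Φ(x, t) = ∫_{[0, t]} ν̄(t - y) P(σ(x) ∈ dy)` on `𝔻`, extended by `0`. -/
def fPhi (T : Characteristics) (σ : ℝ≥0 → Ω → ℝ≥0∞) (P : Measure Ω) (x t : ℝ) : ℝ :=
  if (x, t) ∈ T.domain then (densityIntegral T σ P x t).toReal else 0

end Processes

/-- The two variables of a function `f (x, t)`. -/
inductive Coord where
  | space
  | time
deriving DecidableEq

/-- The first partial derivative of `f` in `x` or in `t`. -/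
def partialDeriv : Coord → (ℝ → ℝ → ℝ) → ℝ → ℝ → ℝ
  | .space, f => fun x t => deriv (fun y => f y t) x
  | .time, f => fun x t => deriv (fun s => f x s) t

/-- Partial differentiability at a point with respect to `x` or to `t`. -/
def PartialDifferentiableAt : Coord → (ℝ → ℝ → ℝ) → ℝ → ℝ → Prop
  | .space, f => fun x t => DifferentiableAt ℝ (fun y => f y t) x
  | .time, f => fun x t => DifferentiableAt ℝ (fun s => f x s) t

/-- The iterated partial derivative in the order prescribed by a word, whose last letter is the
variable of the first differentiation: `[space, time]` stands for `∂_x ∂_t f`. -/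
def mixedPartial : List Coord → (ℝ → ℝ → ℝ) → ℝ → ℝ → ℝ
  | [], f => f
  | c :: w, f => partialDeriv c (mixedPartial w f)

/-- The iterated partial derivative along a word exists at `(x, t)`: the one along the shorter word
exists near `(x, t)` and is partially differentiable at `(x, t)` in the remaining variable. -/
def MixedPartialExistsAt : List Coord → (ℝ → ℝ → ℝ) → ℝ → ℝ → Prop
  | [], _ => fun _ _ => True
  | c :: w, f => fun x t =>
      (∀ᶠ p : ℝ × ℝ in 𝓝 (x, t), MixedPartialExistsAt w f p.1 p.2) ∧
        PartialDifferentiableAt c (mixedPartial w f) x t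

/-- The integrand
`Φ†(z) Φ(z)^k z^{-(1-l)} e^{tz - xΦ(z)}`, `z = a + i b`, of the inversion integral. -/
def bromwichIntegrand (T : Characteristics) (k l : ℕ) (a x t b : ℝ) : ℂ :=
  let z : ℂ := a + b * Complex.I
  T.PhiDag z * T.Phi z ^ k / z ^ (1 - (l : ℤ)) * Complex.exp (t * z - x * T.Phi z)

end KilledSub

end

/-! Write `z = a + ib`. By Fubini, `Φ†(z)/z` is the Laplace transform of `ν̄`
(`PhiDag_eq_tailLaplace`), and `e^{-xΦ(z)}` is that of the law of `σ(x)` on `{σ(x) < ∞}`. The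
convolution `f_Φ(x, ·)` thus has Laplace transform `Φ†(z) e^{-xΦ(z)} / z`, and the formula for `k =
l = 0` is its inversion along `Re z = a`. Under the integral, `∂_x` multiplies by `-Φ(z)` and `∂_t`
by `z`; these multiplications commute, so the order of differentiation is irrelevant.

Everything rests on decay along the line. Since `Re Φ(z) ≥ e^{-a/|b|} b² Δ(|b|) / 5` (`le_re_Phi`),
the growth condition gives `e^{-x Re Φ(z)} ≤ |b|^{-(n+2)}` for large `|b|` as soon as `x >
10(n+2)/L`. As `|Φ(z)| ≤ C|z|` and `Φ†(z)/z` is bounded on the line, the integrands with `k + l ≤ n`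
are `O(b⁻²)`, with dominations that are locally uniform in `x` and in `t`.

For the inversion, the law of `σ(x)` is tilted by `e^{-as}`. The characteristic function becomes
integrable, so there is a density, known almost everywhere (`exists_density`). Convolution with `ν̄`
ignores null sets, so the formula holds at every `t` (`lintegral_tail_eq`). The process enters only
through the transforms `E[e^{-cS(x)}; x < e]` with real `c` (`integral_exp_aliveLaw_ofReal`),
extended to complex `z` by the identity theorem. -/

namespace KilledSub

/-! ### Fourier inversion for finite measures on the line -/

section FourierInversion

open scoped FourierTransform ContDiff Manifold

/-- The Fourier inversion integral of a finite measure on the line. -/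
noncomputable def inversionDensity (m : Measure ℝ) (s : ℝ) : ℂ :=
  (2 * Real.pi : ℂ)⁻¹ * ∫ t : ℝ, Complex.exp (-(t * s) * Complex.I) * charFun m t

/-- Reconciles the kernel `e^{its}` of `charFun` with the kernel `e^{2πivs}` of `𝓕`. -/
lemma inversionDensity_eq_comp_mul (m : Measure ℝ) (s : ℝ) :
    inversionDensity m s =
      ∫ v : ℝ, Complex.exp (((-2 * Real.pi * s * v : ℝ) : ℂ) * Complex.I) *
        charFun m (2 * Real.pi * v) := by
  have := Measure.integral_comp_mul_left
    (fun t : ℝ => Complex.exp (-(t * s) * Complex.I) * charFun m t) (2 * Real.pi)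
  have h2 : |(2 * Real.pi)⁻¹| = (2 * Real.pi)⁻¹ := abs_of_pos (by positivity)
  rw [h2] at this
  unfold inversionDensity
  rw [Complex.real_smul] at this
  push_cast at this ⊢
  rw [← this]
  congr 1 with v
  congr 3
  ring

lemma norm_inversionDensity_le (m : Measure ℝ) (s : ℝ) :
    ‖inversionDensity m s‖ ≤ (2 * Real.pi)⁻¹ * ∫ t : ℝ, ‖charFun m t‖ := by
  unfold inversionDensity
  rw [norm_mul]
  have h2 : ‖(2 * Real.pi : ℂ)⁻¹‖ = (2 * Real.pi)⁻¹ := by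
    rw [norm_inv, norm_mul]
    simp [abs_of_pos Real.pi_pos]
  rw [h2]
  gcongr
  refine (norm_integral_le_integral_norm _).trans (le_of_eq ?_)
  congr 1 with t
  rw [norm_mul]
  have : -((t : ℂ) * s) * Complex.I = ((-(t * s) : ℝ) : ℂ) * Complex.I := by push_cast; ring
  rw [this, Complex.norm_exp_ofReal_mul_I, one_mul]

lemma continuous_inversionDensity {m : Measure ℝ} (h : Integrable (charFun m)) :
    Continuous (inversionDensity m) := by
  unfold inversionDensity
  refine continuous_const.mul ?_
  refine continuous_of_dominated (bound := fun t => ‖charFun m t‖) ?_ ?_ h.norm ?_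
  · intro s
    exact (Continuous.aestronglyMeasurable (by fun_prop)).mul h.aestronglyMeasurable
  · intro s
    refine .of_forall fun t => ?_
    rw [norm_mul]
    have : -((t : ℂ) * s) * Complex.I = ((-(t * s) : ℝ) : ℂ) * Complex.I := by push_cast; ring
    rw [this, Complex.norm_exp_ofReal_mul_I, one_mul]
  · refine .of_forall fun t => ?_
    fun_prop

/-- Test functions are Schwartz, so `g` is the inverse transform of `𝓕 g`. One Fubini turns `∫ g dm`
into the pairing of `charFun m` with `𝓕 g`; a second one, using integrability of `charFun m`, moves
the transform off `g`. -/
lemma integral_eq_integral_smul_inversionDensity (m : Measure ℝ) [IsFiniteMeasure m]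
    (h : Integrable (charFun m)) {g : ℝ → ℝ} (hg : ContDiff ℝ ∞ g) (hc : HasCompactSupport g) :
    ∫ y, (g y : ℂ) ∂m = ∫ s, g s • inversionDensity m s := by
  have hg' : ContDiff ℝ ∞ (fun y => (g y : ℂ)) := Complex.ofRealCLM.contDiff.comp hg
  have hc' : HasCompactSupport (fun y => (g y : ℂ)) := hc.comp_left (g := Complex.ofReal) rfl
  set G : SchwartzMap ℝ ℂ := hc'.toSchwartzMap hg' with hG
  have hGg : ∀ y, G y = (g y : ℂ) := fun y => rfl
  have hFi : Integrable (𝓕 G : SchwartzMap ℝ ℂ) := (𝓕 G).integrable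
  have hinv : ∀ y, (g y : ℂ) =
      ∫ v : ℝ, Complex.exp (((2 * Real.pi * (y * v) : ℝ) : ℂ) * Complex.I) * (𝓕 G) v := by
    intro y
    have h1 : 𝓕⁻ (𝓕 G) = G := FourierTransform.fourierInv_fourier_eq G
    have h2 : (𝓕⁻ (𝓕 G)) y = G y := by rw [h1]
    rw [SchwartzMap.fourierInv_coe, Real.fourierInv_eq'] at h2
    rw [← hGg, ← h2]
    rfl
  have hF : ∀ v, (𝓕 G) v =
      ∫ s : ℝ, Complex.exp (((-2 * Real.pi * (s * v) : ℝ) : ℂ) * Complex.I) * (g s : ℂ) := by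
    intro v
    rw [SchwartzMap.fourier_coe, Real.fourier_real_eq_integral_exp_smul]
    congr 1 with s
    rw [hGg, smul_eq_mul]
    congr 3
    push_cast; ring
  have hgi : Integrable (fun s => (g s : ℂ)) := G.integrable
  calc ∫ y, (g y : ℂ) ∂m
      = ∫ y, (∫ v : ℝ, Complex.exp (((2 * Real.pi * (y * v) : ℝ) : ℂ) * Complex.I) *
          (𝓕 G) v) ∂m := by
        exact integral_congr_ae (.of_forall hinv)
    _ = ∫ v : ℝ, ∫ y, Complex.exp (((2 * Real.pi * (y * v) : ℝ) : ℂ) * Complex.I) *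
          (𝓕 G) v ∂m := by
        refine integral_integral_swap ?_
        have hm : Integrable (fun p : ℝ × ℝ => (𝓕 G) p.2) (m.prod volume) :=
          hFi.comp_snd m
        refine hm.mono (Continuous.aestronglyMeasurable ?_) (.of_forall fun p => ?_)
        · exact Continuous.mul (by fun_prop) ((𝓕 G).continuous.comp continuous_snd)
        · simp only [Function.uncurry]
          rw [norm_mul, Complex.norm_exp_ofReal_mul_I, one_mul]
    _ = ∫ v : ℝ, charFun m (2 * Real.pi * v) * (𝓕 G) v := by
        congr 1 with v
        rw [integral_mul_const, charFun_apply_real]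
        congr 2 with y
        congr 1
        push_cast; ring
    _ = ∫ v : ℝ, ∫ s : ℝ, charFun m (2 * Real.pi * v) *
          (Complex.exp (((-2 * Real.pi * (s * v) : ℝ) : ℂ) * Complex.I) * (g s : ℂ)) := by
        congr 1 with v
        rw [hF, integral_const_mul]
    _ = ∫ s : ℝ, ∫ v : ℝ, charFun m (2 * Real.pi * v) *
          (Complex.exp (((-2 * Real.pi * (s * v) : ℝ) : ℂ) * Complex.I) * (g s : ℂ)) := by
        rw [integral_integral_swap]
        have h' : Integrable (fun v : ℝ => charFun m (2 * Real.pi * v)) :=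
          h.comp_mul_left' (by positivity)
        refine (h'.mul_prod hgi).mono ?_ (.of_forall fun p => ?_)
        · refine (h'.aestronglyMeasurable.comp_fst).mul (Continuous.aestronglyMeasurable ?_)
          exact Continuous.mul (by fun_prop) (hg'.continuous.comp continuous_snd)
        · simp only [Function.uncurry]
          rw [norm_mul, norm_mul, Complex.norm_exp_ofReal_mul_I, one_mul, norm_mul]
    _ = ∫ s, g s • inversionDensity m s := by
        congr 1 with s
        rw [inversionDensity_eq_comp_mul, Complex.real_smul, ← integral_const_mul]
        congr 1 with v
        push_cast
        ring_nf

/-- The candidate density is bounded by a constant `M`. A bump function between a null compact set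
`K` and an open `U ⊇ K` of small measure then gives `m(K) ≤ M |U|`, hence `m(K) = 0`; inner
regularity does the rest. -/
lemma absolutelyContinuous_of_integrable_charFun (m : Measure ℝ) [IsFiniteMeasure m]
    (h : Integrable (charFun m)) : m ≪ volume := by
  refine Measure.AbsolutelyContinuous.mk fun N hN hN0 => ?_
  by_contra hne
  obtain ⟨K, hKN, hK, hmK⟩ := hN.exists_lt_isCompact (pos_iff_ne_zero.2 hne)
  have hK0 : volume K = 0 := measure_mono_null hKN hN0
  set M := (2 * Real.pi)⁻¹ * ∫ t : ℝ, ‖charFun m t‖ with hM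
  have hM0 : 0 ≤ M := by positivity
  have key : ∀ ε : ℝ, 0 < ε → m.real K ≤ M * ε := by
    intro ε hε
    obtain ⟨U₀, hKU₀, hU₀, hU₀ε⟩ := K.exists_isOpen_lt_of_lt (μ := volume) (ENNReal.ofReal ε)
      (by rw [hK0]; exact ENNReal.ofReal_pos.2 hε)
    obtain ⟨R, hR⟩ := hK.isBounded.subset_ball 0
    -- The ball makes the support of the bump function relatively compact.
    set U := U₀ ∩ Metric.ball 0 R with hUdef
    have hU : IsOpen U := hU₀.inter Metric.isOpen_ball
    have hKU : K ⊆ U := subset_inter hKU₀ hR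
    have hUε : volume U ≤ ENNReal.ofReal ε := (measure_mono inter_subset_left).trans hU₀ε.le
    obtain ⟨g, hg, hgr, hgs, hg1⟩ :=
      exists_contMDiff_support_eq_eq_one_iff (n := (⊤ : ℕ∞)) 𝓘(ℝ, ℝ) hU hK.isClosed hKU
    have hgc : HasCompactSupport g := by
      refine HasCompactSupport.of_support_subset_isCompact (isCompact_closedBall (0 : ℝ) R) ?_
      rw [hgs]
      exact inter_subset_right.trans Metric.ball_subset_closedBall
    have e := integral_eq_integral_smul_inversionDensity m h hg.contDiff hgc
    have hg0 : ∀ y, 0 ≤ g y := fun y => (hgr (mem_range_self y)).1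
    have hgle : ∀ y, g y ≤ 1 := fun y => (hgr (mem_range_self y)).2
    have e0 : ∫ y, (g y : ℂ) ∂m = ((∫ y, g y ∂m : ℝ) : ℂ) := integral_ofReal
    rw [e0] at e
    have e1 : m.real K ≤ ∫ y, g y ∂m := by
      rw [← integral_indicator_one hK.measurableSet]
      refine integral_mono ?_ (hg.contDiff.continuous.integrable_of_hasCompactSupport hgc) ?_
      · exact (integrable_const 1).indicator hK.measurableSet
      · intro y
        by_cases hy : y ∈ K
        · simp [hy, (hg1 y).1 hy]
        · simp [hy, hg0 y]
    have e2 : ‖∫ s, g s • inversionDensity m s‖ ≤ M * volume.real U := by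
      calc ‖∫ s, g s • inversionDensity m s‖ ≤ ∫ s, U.indicator (fun _ => M) s := by
            refine norm_integral_le_of_norm_le ?_ (.of_forall fun s => ?_)
            · exact (integrableOn_const (hs := (hUε.trans_lt ENNReal.ofReal_lt_top).ne)).integrable_indicator
                hU.measurableSet
            · by_cases hs : s ∈ U
              · rw [norm_smul, indicator_of_mem hs, Real.norm_of_nonneg (hg0 s)]
                calc g s * ‖inversionDensity m s‖ ≤ 1 * M :=
                      mul_le_mul (hgle s) (norm_inversionDensity_le m s) (norm_nonneg _) zero_le_one
                  _ = M := one_mul M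
              · have : g s = 0 := by rw [← Function.notMem_support, hgs]; exact hs
                simp [this, hs]
        _ = M * volume.real U := by
            rw [integral_indicator hU.measurableSet]
            simp [mul_comm]
    rw [← e, Complex.norm_real, Real.norm_of_nonneg (integral_nonneg hg0)] at e2
    refine e1.trans (e2.trans ?_)
    gcongr
    exact ENNReal.toReal_le_of_le_ofReal hε.le hUε
  have hlim : m.real K ≤ 0 := by
    refine le_of_forall_pos_le_add fun δ hδ => ?_
    -- `M + 1` in place of `M`, which may vanish.
    have := key (δ / (M + 1)) (by positivity)
    refine this.trans ?_
    rw [zero_add, mul_div_assoc', div_le_iff₀ (by positivity)]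
    nlinarith
  have : 0 < m.real K := ENNReal.toReal_pos hmK.ne' (measure_ne_top _ _)
  linarith

theorem ae_rnDeriv_eq_inversionDensity (m : Measure ℝ) [IsFiniteMeasure m]
    (h : Integrable (charFun m)) :
    ∀ᵐ s, ((m.rnDeriv volume s).toReal : ℂ) = inversionDensity m s := by
  have hac := absolutelyContinuous_of_integrable_charFun m h
  refine ae_eq_of_integral_contDiff_smul_eq ?_ (continuous_inversionDensity h).locallyIntegrable ?_
  · exact (Measure.integrable_toReal_rnDeriv (μ := m) (ν := volume)).ofReal.locallyIntegrable
  · intro g hg hc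
    rw [← integral_eq_integral_smul_inversionDensity m h hg hc]
    have := integral_rnDeriv_smul (μ := m) (ν := volume) hac (f := fun y => (g y : ℂ))
    rw [← this]
    congr 1 with s
    simp only [Complex.real_smul]
    ring

end FourierInversion

/-! ### The Lévy tail, its Laplace transform and bounds on `Φ` -/

namespace Characteristics

variable (T : Characteristics)

lemma ae_levy_pos : ∀ᵐ y ∂T.levy, 0 < y := by
  have : {y : ℝ | ¬ 0 < y} = Iic 0 := by ext; simp
  rw [ae_iff, this, T.levy_Iic]

lemma levy_restrict_Ioi : T.levy.restrict (Ioi 0) = T.levy :=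
  Measure.restrict_eq_self_of_ae_mem T.ae_levy_pos

lemma ae_levy_min_pos : ∀ᵐ y ∂T.levy, 0 < min y 1 := by
  filter_upwards [T.ae_levy_pos] with y hy using lt_min hy one_pos

lemma integrable_min : Integrable (fun y => min y 1) T.levy := by
  refine ⟨by fun_prop, ?_⟩
  rw [hasFiniteIntegral_iff_ofReal]
  · exact T.lintegral_min_lt_top
  · filter_upwards [T.ae_levy_min_pos] with y hy using hy.le

/-- `min(y, 1) ν(dy)` is finite, and `ν` is recovered from it through the density `1 / min(y, 1)`,
the weight being positive `ν`-almost everywhere. Fubini needs this. -/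
instance sFinite_levy : SFinite T.levy := by
  set f : ℝ → ℝ≥0∞ := fun y => ENNReal.ofReal (min y 1) with hf
  have hfm : Measurable f := by fun_prop
  have h := withDensity_inv_same (μ := T.levy) hfm
    (by filter_upwards [T.ae_levy_min_pos] with y hy; simpa [hf] using hy)
    (.of_forall fun y => by simp [hf])
  have : IsFiniteMeasure (T.levy.withDensity f) :=
    isFiniteMeasure_withDensity T.lintegral_min_lt_top.ne
  rw [← h]
  infer_instance

lemma tail_antitone : Antitone T.tail := fun _ _ h => measure_mono (Ioi_subset_Ioi h)

lemma measurable_tail : Measurable T.tail := T.tail_antitone.measurable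

lemma tail_lt_top {s : ℝ} (hs : 0 < s) : T.tail s < ⊤ := by
  have h := (T.integrable_min).measure_gt_lt_top (ε := min s 1 / 2)
    (by have := lt_min hs one_pos; linarith)
  refine (measure_mono ?_).trans_lt h
  intro y hy
  have h1 : 0 < min s 1 := lt_min hs one_pos
  have h2 : min s 1 ≤ min y 1 := min_le_min_right _ (le_of_lt hy)
  change min s 1 / 2 < min y 1
  linarith

/-- The measure with density `ν̄` on `(0, ∞)`. -/
noncomputable def tailMeasure : Measure ℝ := (volume.restrict (Ioi 0)).withDensity T.tail

instance sFinite_tailMeasure : SFinite T.tailMeasure := by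
  unfold tailMeasure; infer_instance

/-- The Laplace transform of `ν̄`. -/
noncomputable def tailLaplace (z : ℂ) : ℂ := ∫ u : ℝ, Complex.exp (-z * u) ∂T.tailMeasure

lemma norm_cexp_neg_mul (z : ℂ) (u : ℝ) : ‖Complex.exp (-z * u)‖ = Real.exp (-z.re * u) := by
  rw [Complex.norm_exp]; simp

lemma setIntegral_indicator_exp {y : ℝ} (hy : 0 < y) (z : ℂ) (hz : z ≠ 0) :
    ∫ u : ℝ in Ioi 0, (Ioi u).indicator (fun _ => Complex.exp (-z * u)) y
      = (1 - Complex.exp (-z * y)) / z := by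
  have h1 : ∀ u : ℝ, (Ioi u).indicator (fun _ => Complex.exp (-z * u)) y
      = (Iio y).indicator (fun u : ℝ => Complex.exp (-z * u)) u := by
    intro u
    by_cases h : u < y <;> simp [h]
  simp_rw [h1]
  rw [setIntegral_indicator measurableSet_Iio, Ioi_inter_Iio, ← integral_Ioc_eq_integral_Ioo,
    ← intervalIntegral.integral_of_le hy.le, integral_exp_mul_complex (neg_ne_zero.2 hz)]
  simp only [Complex.ofReal_zero, mul_zero, Complex.exp_zero]
  rw [div_neg, ← neg_div, neg_sub]

lemma norm_one_sub_cexp_le {z : ℂ} (hz : 0 ≤ z.re) {y : ℝ} (hy : 0 < y) :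
    ‖1 - Complex.exp (-z * y)‖ ≤ (‖z‖ + 2) * min y 1 := by
  rcases eq_or_ne z 0 with rfl | h0
  · simp; positivity
  have hn : ∀ u : ℝ, 0 ≤ u → ‖Complex.exp (-z * u)‖ ≤ 1 := by
    intro u hu
    rw [norm_cexp_neg_mul, Real.exp_le_one_iff]
    nlinarith
  rcases le_total y 1 with h | h
  · rw [min_eq_left h]
    have e : 1 - Complex.exp (-z * y) = z * ∫ u in (0 : ℝ)..y, Complex.exp (-z * u) := by
      rw [integral_exp_mul_complex (neg_ne_zero.2 h0)]
      field_simp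
      simp
    have h2 : ‖∫ u in (0 : ℝ)..y, Complex.exp (-z * u)‖ ≤ 1 * |y - 0| :=
      intervalIntegral.norm_integral_le_of_norm_le_const fun u hu => by
        rw [uIoc_of_le hy.le] at hu
        exact hn u hu.1.le
    rw [sub_zero, abs_of_pos hy, one_mul] at h2
    rw [e, norm_mul]
    nlinarith [norm_nonneg z]
  · rw [min_eq_right h, mul_one]
    refine (norm_sub_le _ _).trans ?_
    have := hn y hy.le
    rw [norm_one]
    linarith [norm_nonneg z]

lemma integrable_one_sub_cexp {z : ℂ} (hz : 0 ≤ z.re) :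
    Integrable (fun y : ℝ => 1 - Complex.exp (-z * y)) T.levy := by
  refine (T.integrable_min.const_mul (‖z‖ + 2)).mono' (by fun_prop) ?_
  filter_upwards [T.ae_levy_pos] with y hy using norm_one_sub_cexp_le hz hy

/-- The norm of the integrand is the same integrand at the real point `Re z`. Its `u`-integral is
`(1 - e^{-y Re z}) / Re z`, which is `ν`-integrable. -/
lemma integrable_indicator_exp {z : ℂ} (hz : 0 < z.re) :
    Integrable (fun p : ℝ × ℝ => (Ioi p.2).indicator (fun _ => Complex.exp (-z * p.2)) p.1)
      (T.levy.prod (volume.restrict (Ioi 0))) := by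
  have hmeas : Measurable
      (fun p : ℝ × ℝ => (Ioi p.2).indicator (fun _ => Complex.exp (-z * p.2)) p.1) := by
    have : (fun p : ℝ × ℝ => (Ioi p.2).indicator (fun _ => Complex.exp (-z * p.2)) p.1)
        = {p : ℝ × ℝ | p.2 < p.1}.indicator (fun p => Complex.exp (-z * p.2)) := by
      ext p
      by_cases h : p.2 < p.1 <;> simp [h]
    rw [this]
    exact Measurable.indicator (by fun_prop) (measurableSet_lt measurable_snd measurable_fst)
  have hnorm : ∀ y u : ℝ, ((‖(Ioi u).indicator (fun _ => Complex.exp (-z * u)) y‖ : ℝ) : ℂ)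
      = (Ioi u).indicator (fun _ => Complex.exp (-(z.re : ℂ) * u)) y := by
    intro y u
    by_cases h : u < y
    · simp only [mem_Ioi, h, indicator_of_mem]
      rw [norm_cexp_neg_mul]; push_cast; rfl
    · simp [h]
  rw [integrable_prod_iff hmeas.aestronglyMeasurable]
  constructor
  · refine .of_forall fun y => ?_
    have hi : IntegrableOn (fun u : ℝ => Real.exp (-z.re * u)) (Ioi 0) :=
      integrableOn_exp_mul_Ioi (neg_lt_zero.2 hz) 0
    refine Integrable.mono' hi (hmeas.comp (measurable_prodMk_left)).aestronglyMeasurable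
      (.of_forall fun u => ?_)
    refine (norm_indicator_le_norm_self _ _).trans ?_
    rw [norm_cexp_neg_mul]
  · have hz' : (0 : ℝ) ≤ ((z.re : ℂ)).re := by simpa using hz.le
    refine ((T.integrable_one_sub_cexp hz').div_const (z.re : ℂ)).norm.congr ?_
    filter_upwards [T.ae_levy_pos] with y hy
    have h0 : (z.re : ℂ) ≠ 0 := by exact_mod_cast hz.ne'
    rw [← setIntegral_indicator_exp hy _ h0]
    simp_rw [← hnorm]
    rw [integral_complex_ofReal, Complex.norm_real]
    refine (Real.norm_of_nonneg ?_)
    exact integral_nonneg fun u => norm_nonneg _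

lemma integral_indicator_exp (z : ℂ) (u : ℝ) :
    ∫ y, (Ioi u).indicator (fun _ => Complex.exp (-z * u)) y ∂T.levy
      = (T.tail u).toReal • Complex.exp (-z * u) := by
  rw [integral_indicator measurableSet_Ioi, setIntegral_const]
  rfl

lemma ae_tail_lt_top : ∀ᵐ u ∂(volume.restrict (Ioi (0 : ℝ))), T.tail u < ⊤ :=
  (ae_restrict_iff' measurableSet_Ioi).2 (.of_forall fun _ hu => T.tail_lt_top hu)

lemma integrable_cexp_tailMeasure {z : ℂ} (hz : 0 < z.re) :
    Integrable (fun u : ℝ => Complex.exp (-z * u)) T.tailMeasure := by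
  unfold tailMeasure
  rw [integrable_withDensity_iff_integrable_smul' T.measurable_tail T.ae_tail_lt_top]
  refine (T.integrable_indicator_exp hz).integral_prod_right.congr (.of_forall fun u => ?_)
  exact T.integral_indicator_exp z u

lemma integrable_exp_tailMeasure {a : ℝ} (ha : 0 < a) :
    Integrable (fun u : ℝ => Real.exp (-a * u)) T.tailMeasure := by
  have := (T.integrable_cexp_tailMeasure (z := a) (by simpa using ha)).norm
  simpa only [norm_cexp_neg_mul, Complex.ofReal_re] using this

/-- Fubini for `(1 - e^{-zy}) / z = ∫_0^y e^{-zu} du`: the `ν`-mass of `{y > u}` is `ν̄(u)`. -/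
lemma integral_one_sub_cexp {z : ℂ} (hz : 0 < z.re) :
    ∫ y : ℝ, (1 - Complex.exp (-z * y)) ∂T.levy = z * T.tailLaplace z := by
  have h0 : z ≠ 0 := by rintro rfl; simp at hz
  have e1 : T.tailLaplace z = ∫ y : ℝ, (1 - Complex.exp (-z * y)) / z ∂T.levy := by
    unfold tailLaplace tailMeasure
    rw [integral_withDensity_eq_integral_toReal_smul T.measurable_tail T.ae_tail_lt_top]
    simp_rw [← T.integral_indicator_exp]
    rw [integral_integral_swap (f := fun (u y : ℝ) =>
      (Ioi u).indicator (fun _ => Complex.exp (-z * u)) y) (T.integrable_indicator_exp hz).swap]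
    refine integral_congr_ae ?_
    filter_upwards [T.ae_levy_pos] with y hy
    exact setIntegral_indicator_exp hy z h0
  rw [e1, integral_div, mul_div_cancel₀ _ h0]

lemma Phi_eq (z : ℂ) :
    T.Phi z = T.q + T.drift * z + ∫ y : ℝ, (1 - Complex.exp (-z * y)) ∂T.levy := by
  rw [Phi, levy_restrict_Ioi]

lemma Phi_eq_tailLaplace {z : ℂ} (hz : 0 < z.re) :
    T.Phi z = T.q + T.drift * z + z * T.tailLaplace z := by
  rw [Phi_eq, T.integral_one_sub_cexp hz]

lemma PhiDag_eq_tailLaplace {z : ℂ} (hz : 0 < z.re) : T.PhiDag z = z * T.tailLaplace z := by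
  rw [PhiDag, T.Phi_eq_tailLaplace hz]; ring

/-- The transform is the complex moment generating function at `-z`, which is holomorphic over the
interior of the set of integrable exponents; that set contains `(-∞, 0)`. -/
lemma differentiableAt_tailLaplace {z : ℂ} (hz : 0 < z.re) :
    DifferentiableAt ℂ T.tailLaplace z := by
  have e : T.tailLaplace = fun z => complexMGF id T.tailMeasure (-z) := rfl
  have hsub : Iio (0 : ℝ) ⊆ integrableExpSet id T.tailMeasure := by
    intro s hs
    have := T.integrable_exp_tailMeasure (a := -s) (by simpa using hs)
    simpa [integrableExpSet] using this
  have hint : (-z).re ∈ interior (integrableExpSet id T.tailMeasure) :=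
    interior_maximal hsub isOpen_Iio (by simpa using hz)
  rw [e]
  exact (hasDerivAt_complexMGF hint).differentiableAt.comp z differentiableAt_id.neg

lemma differentiableAt_Phi {z : ℂ} (hz : 0 < z.re) : DifferentiableAt ℂ T.Phi z := by
  have h : DifferentiableAt ℂ (fun z => T.q + T.drift * z + z * T.tailLaplace z) z := by
    have := T.differentiableAt_tailLaplace hz
    fun_prop
  refine h.congr_of_eventuallyEq ?_
  have : ∀ᶠ w : ℂ in 𝓝 z, 0 < w.re := (isOpen_lt continuous_const Complex.continuous_re).mem_nhds hz
  filter_upwards [this] with w hw using T.Phi_eq_tailLaplace hw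

lemma norm_tailLaplace_le (z : ℂ) :
    ‖T.tailLaplace z‖ ≤ ∫ u : ℝ, Real.exp (-z.re * u) ∂T.tailMeasure := by
  refine (norm_integral_le_integral_norm _).trans (le_of_eq ?_)
  simp only [norm_cexp_neg_mul]

/-- The constant `q` is absorbed by `|z| ≥ a`; the transform of `ν̄` is bounded on the line by its
value at `a`. -/
lemma exists_norm_Phi_le {a : ℝ} (ha : 0 < a) :
    ∃ C : ℝ, 0 ≤ C ∧ ∀ z : ℂ, z.re = a → ‖T.Phi z‖ ≤ C * ‖z‖ := by
  refine ⟨T.q / a + T.drift + ∫ u : ℝ, Real.exp (-a * u) ∂T.tailMeasure, ?_, fun z hz => ?_⟩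
  · have := T.q_nonneg
    have := T.drift_nonneg
    positivity
  · have hza : a ≤ ‖z‖ := hz ▸ Complex.re_le_norm z
    rw [T.Phi_eq_tailLaplace (hz ▸ ha)]
    have h1 := T.norm_tailLaplace_le z
    rw [hz] at h1
    have h2 : T.q ≤ T.q / a * ‖z‖ := by
      rw [div_mul_eq_mul_div, le_div_iff₀ ha]
      exact mul_le_mul_of_nonneg_left hza T.q_nonneg
    refine norm_add₃_le.trans ?_
    rw [norm_mul, norm_mul, Complex.norm_real, Complex.norm_real, Real.norm_of_nonneg T.q_nonneg,
      Real.norm_of_nonneg T.drift_nonneg]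
    nlinarith [norm_nonneg z]

lemma re_Phi {z : ℂ} (hz : 0 ≤ z.re) :
    (T.Phi z).re = T.q + T.drift * z.re +
      ∫ y : ℝ, (1 - Real.exp (-z.re * y) * Real.cos (z.im * y)) ∂T.levy := by
  rw [Phi_eq]
  have h : (∫ y : ℝ, (1 - Complex.exp (-z * y)) ∂T.levy).re
      = ∫ y : ℝ, (1 - Complex.exp (-z * y)).re ∂T.levy :=
    ((RCLike.reCLM (K := ℂ)).integral_comp_comm (T.integrable_one_sub_cexp hz)).symm
  rw [Complex.add_re, h]
  simp [Complex.exp_re]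

lemma integrable_one_sub_exp_mul_cos {z : ℂ} (hz : 0 ≤ z.re) :
    Integrable (fun y : ℝ => 1 - Real.exp (-z.re * y) * Real.cos (z.im * y)) T.levy := by
  have := (T.integrable_one_sub_cexp hz).re
  simpa [Complex.exp_re] using this

lemma re_Phi_nonneg {z : ℂ} (hz : 0 ≤ z.re) : 0 ≤ (T.Phi z).re := by
  rw [T.re_Phi hz]
  have h1 := T.q_nonneg
  have h2 := T.drift_nonneg
  have h3 : 0 ≤ ∫ y : ℝ, (1 - Real.exp (-z.re * y) * Real.cos (z.im * y)) ∂T.levy := by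
    refine integral_nonneg_of_ae ?_
    filter_upwards [T.ae_levy_pos] with y hy
    have h4 : Real.exp (-z.re * y) ≤ 1 := Real.exp_le_one_iff.2 (by nlinarith)
    have h5 := Real.cos_le_one (z.im * y)
    have h6 := Real.exp_pos (-z.re * y)
    simp only [Pi.zero_apply]
    nlinarith
  positivity

lemma Delta_nonneg (x : ℝ) : 0 ≤ T.Delta x :=
  integral_nonneg fun y => sq_nonneg y

/-- The integrand of `Re Φ` is nonnegative, so only the jumps `y ≤ 1/|b|`, with `b = Im z`, are
kept. There `|by| ≤ 1`, so `1 - cos(by)` is comparable with `(by)²`, and the exponential factor is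
at least `e^{-Re z/|b|}`. -/
lemma le_re_Phi {z : ℂ} (hz : 0 ≤ z.re) (hb : z.im ≠ 0) :
    Real.exp (-z.re / |z.im|) / 5 * (z.im ^ 2 * T.Delta |z.im|) ≤ (T.Phi z).re := by
  rw [T.re_Phi hz]
  have hb' : 0 < |z.im| := abs_pos.2 hb
  have h1 := T.q_nonneg
  have h2 := mul_nonneg T.drift_nonneg hz
  have hpt : ∀ᵐ y ∂T.levy, (Ioc 0 (1 / |z.im|)).indicator
      (fun y => Real.exp (-z.re / |z.im|) / 5 * (z.im ^ 2 * y ^ 2)) y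
      ≤ 1 - Real.exp (-z.re * y) * Real.cos (z.im * y) := by
    filter_upwards [T.ae_levy_pos] with y hy
    have h4 : Real.exp (-z.re * y) ≤ 1 := Real.exp_le_one_iff.2 (by nlinarith)
    have h5 := Real.cos_le_one (z.im * y)
    have h6 := Real.exp_pos (-z.re * y)
    by_cases hm : y ∈ Ioc 0 (1 / |z.im|)
    · rw [indicator_of_mem hm]
      have h7 : |z.im * y| ≤ 1 := by
        rw [abs_mul, abs_of_pos hy, mul_comm]
        exact (le_div_iff₀ hb').1 hm.2
      -- `cos u ≤ 1 - 2u²/π²` for `|u| ≤ π`, and `π² ≤ 10`.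
      have h8 : Real.cos (z.im * y) ≤ 1 - 1 / 5 * (z.im * y) ^ 2 := by
        have := Real.cos_le_one_sub_mul_cos_sq (x := z.im * y)
          (h7.trans (by linarith [Real.pi_gt_three]))
        have h9 : 1 / 5 ≤ 2 / Real.pi ^ 2 := by
          rw [div_le_div_iff₀ (by norm_num) (by positivity)]
          nlinarith [Real.pi_lt_d2, Real.pi_gt_three]
        nlinarith [sq_nonneg (z.im * y)]
      have h9 : Real.exp (-z.re / |z.im|) ≤ Real.exp (-z.re * y) := by
        rw [Real.exp_le_exp, neg_div, neg_mul, neg_le_neg_iff, div_eq_mul_one_div]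
        exact mul_le_mul_of_nonneg_left hm.2 hz
      calc Real.exp (-z.re / |z.im|) / 5 * (z.im ^ 2 * y ^ 2)
          ≤ Real.exp (-z.re * y) * (1 / 5 * (z.im * y) ^ 2) := by
            have : 0 ≤ 1 / 5 * (z.im * y) ^ 2 := by positivity
            calc _ = Real.exp (-z.re / |z.im|) * (1 / 5 * (z.im * y) ^ 2) := by ring
              _ ≤ _ := mul_le_mul_of_nonneg_right h9 this
        _ ≤ Real.exp (-z.re * y) * (1 - Real.cos (z.im * y)) :=
            mul_le_mul_of_nonneg_left (by linarith) h6.le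
        _ ≤ _ := by nlinarith
    · rw [indicator_of_notMem hm]
      nlinarith
  have hint : Integrable ((Ioc 0 (1 / |z.im|)).indicator
      (fun y => Real.exp (-z.re / |z.im|) / 5 * (z.im ^ 2 * y ^ 2))) T.levy := by
    refine (T.integrable_one_sub_exp_mul_cos hz).mono'
      (Measurable.indicator (by fun_prop) measurableSet_Ioc).aestronglyMeasurable ?_
    filter_upwards [hpt] with y hy
    rwa [Real.norm_of_nonneg]
    exact indicator_nonneg (fun y _ => by positivity) y
  have := integral_mono_ae hint (T.integrable_one_sub_exp_mul_cos hz) hpt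
  rw [integral_indicator measurableSet_Ioc, integral_const_mul, integral_const_mul] at this
  unfold Delta
  linarith

end Characteristics

/-! ### Decay of `e^{-xΦ}` on vertical lines -/

/-- Beyond `x = threshold n L`, the inversion integrals of total order at most `n` converge. -/
noncomputable def threshold (n : ℕ) (L : ℝ≥0∞) : ℝ := 10 * (n + 2) / L.toReal

lemma threshold_nonneg (n : ℕ) (L : ℝ≥0∞) : 0 ≤ threshold n L := by
  unfold threshold; positivity

/-- Relies on the conventions `(⊤ : ℝ≥0∞).toReal = 0` and `r / 0 = 0`. -/
lemma threshold_top (n : ℕ) : threshold n ⊤ = 0 := by simp [threshold]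

namespace Characteristics

variable {T : Characteristics}

/-- Being beyond the threshold means `10(n+2)/x < L`, and a number strictly below a lower limit is
eventually below the function. -/
lemma GrowthCondition.eventually_mul_log_le {L : ℝ≥0∞} (h : T.GrowthCondition L) {n : ℕ} {x : ℝ}
    (hx : threshold n L < x) :
    ∀ᶠ b : ℝ in atTop, 10 * (n + 2) / x * Real.log b ≤ b ^ 2 * T.Delta b := by
  have hx0 : 0 < x := (threshold_nonneg n L).trans_lt hx
  have hlt : ENNReal.ofReal (10 * (n + 2) / x) < L := by
    rcases eq_or_ne L ⊤ with rfl | hL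
    · exact ENNReal.ofReal_lt_top
    · have hL0 : 0 < L.toReal := ENNReal.toReal_pos h.1.ne' hL
      rw [ENNReal.ofReal_lt_iff_lt_toReal (by positivity) hL, div_lt_iff₀ hx0, mul_comm L.toReal]
      exact (div_lt_iff₀ hL0).1 hx
  rw [← h.2] at hlt
  filter_upwards [eventually_lt_of_lt_liminf hlt, eventually_gt_atTop 1] with b hb hb1
  have hlog : 0 < Real.log b := Real.log_pos hb1
  have := ENNReal.lt_ofReal_iff_toReal_lt ENNReal.ofReal_ne_top |>.1 hb
  rw [ENNReal.toReal_ofReal (by positivity)] at this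
  exact ((lt_div_iff₀ hlog).1 this).le

lemma GrowthCondition.exists_exp_neg_re_Phi_le {L : ℝ≥0∞} (h : T.GrowthCondition L) {n : ℕ} {x : ℝ}
    (hx : threshold n L < x) {a : ℝ} (ha : 0 < a) :
    ∃ R : ℝ, ∀ b : ℝ, R ≤ |b| →
      Real.exp (-x * (T.Phi (a + b * Complex.I)).re) ≤ (|b| ^ (n + 2))⁻¹ := by
  have hx0 : 0 < x := (threshold_nonneg n L).trans_lt hx
  have hlim : Tendsto (fun b : ℝ => Real.exp (-a / b)) atTop (𝓝 1) := by
    have : Tendsto (fun b : ℝ => -a / b) atTop (𝓝 0) := tendsto_const_nhds.div_atTop tendsto_id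
    simpa [Function.comp_def] using (Real.continuous_exp.tendsto 0).comp this
  obtain ⟨R, hR⟩ := eventually_atTop.1 ((h.eventually_mul_log_le hx).and
    ((hlim.eventually (eventually_ge_nhds (show (1 / 2 : ℝ) < 1 by norm_num))).and
      (eventually_ge_atTop 1)))
  refine ⟨R, fun b hb => ?_⟩
  obtain ⟨h1, h2, h3⟩ := hR |b| hb
  have hb0 : 0 < |b| := one_pos.trans_le h3
  set z : ℂ := a + b * Complex.I with hz
  have hre : z.re = a := by simp [hz]
  have him : z.im = b := by simp [hz]
  have h4 := T.le_re_Phi (z := z) (by rw [hre]; exact ha.le) (by rw [him]; exact abs_pos.1 hb0)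
  rw [hre, him] at h4
  have h5 : 0 ≤ b ^ 2 * T.Delta |b| := mul_nonneg (sq_nonneg b) (T.Delta_nonneg _)
  rw [sq_abs] at h1
  have hlog : 0 ≤ Real.log |b| := Real.log_nonneg h3
  -- The factor 10 of the threshold is spent here: `1/5` comes from the cosine bound and `1/2` from
  -- `e^{-a/|b|} ≥ 1/2`.
  have h6 : (n + 2) / x * Real.log |b| ≤ (T.Phi z).re := by
    have e : 10 * ((n : ℝ) + 2) / x * Real.log |b| = 10 * ((n + 2) / x * Real.log |b|) := by ring
    rw [e] at h1
    nlinarith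
  have h7 : (n + 2) * Real.log |b| ≤ x * (T.Phi z).re := by
    have := mul_le_mul_of_nonneg_left h6 hx0.le
    calc (n + 2) * Real.log |b| = x * ((n + 2) / x * Real.log |b|) := by field_simp
      _ ≤ _ := this
  calc Real.exp (-x * (T.Phi z).re) ≤ Real.exp (-(((n + 2 : ℕ) : ℝ) * Real.log |b|)) := by
        rw [Real.exp_le_exp]; push_cast; linarith
    _ = (|b| ^ (n + 2))⁻¹ := by
        rw [Real.exp_neg, mul_comm, Real.exp_mul, Real.exp_log hb0, Real.rpow_natCast]

lemma GrowthCondition.exists_pow_mul_exp_le {L : ℝ≥0∞} (h : T.GrowthCondition L) {n : ℕ} {x : ℝ}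
    (hx : threshold n L < x) {a : ℝ} (ha : 0 < a) {m : ℕ} (hm : m ≤ n) :
    ∃ C : ℝ, ∀ b : ℝ, ‖(a + b * Complex.I : ℂ)‖ ^ m *
      Real.exp (-x * (T.Phi (a + b * Complex.I)).re) ≤ C * (1 + b ^ 2)⁻¹ := by
  have hx0 : 0 < x := (threshold_nonneg n L).trans_lt hx
  obtain ⟨R₀, hR₀⟩ := h.exists_exp_neg_re_Phi_le hx ha
  set R := max R₀ (max 1 a) with hR
  have hR1 : 1 ≤ R := (le_max_left _ _).trans (le_max_right _ _)
  have hRa : a ≤ R := (le_max_right _ _).trans (le_max_right _ _)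
  -- The first constant serves `|b| ≥ R`, where `|z| ≤ 2|b|` and `1 + b² ≤ 2b²`; the second serves
  -- `|b| ≤ R`, where the exponential is at most 1.
  refine ⟨max (2 ^ n * 2) ((a + R) ^ m * (1 + R ^ 2)), fun b => ?_⟩
  have hz : ‖(a + b * Complex.I : ℂ)‖ ≤ a + |b| := by
    refine (norm_add_le _ _).trans (le_of_eq ?_)
    simp [abs_of_pos ha]
  have hpos : (0 : ℝ) < 1 + b ^ 2 := by positivity
  rw [← div_eq_mul_inv, le_div_iff₀ hpos]
  rcases le_total R |b| with hb | hb
  · refine le_trans ?_ (le_max_left _ _)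
    have hb1 : 1 ≤ |b| := hR1.trans hb
    have hb0 : 0 < |b| := one_pos.trans_le hb1
    have h1 : ‖(a + b * Complex.I : ℂ)‖ ^ m ≤ (2 * |b|) ^ n :=
      (pow_le_pow_left₀ (norm_nonneg _) (by linarith) m).trans
        (pow_le_pow_right₀ (by linarith) hm)
    have h2 := hR₀ b ((le_max_left _ _).trans hb)
    have h3 : 1 + b ^ 2 ≤ 2 * |b| ^ 2 := by nlinarith [sq_abs b]
    calc _ ≤ (2 * |b|) ^ n * (|b| ^ (n + 2))⁻¹ * (2 * |b| ^ 2) := by gcongr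
      _ = 2 ^ n * 2 := by field_simp; ring
  · refine le_trans ?_ (le_max_right _ _)
    have h1 : ‖(a + b * Complex.I : ℂ)‖ ^ m ≤ (a + R) ^ m :=
      pow_le_pow_left₀ (norm_nonneg _) (by linarith) m
    have h2 : Real.exp (-x * (T.Phi (a + b * Complex.I)).re) ≤ 1 := by
      have := T.re_Phi_nonneg (z := a + b * Complex.I) (by simpa using ha.le)
      rw [Real.exp_le_one_iff]; nlinarith
    have h3 : b ^ 2 ≤ R ^ 2 := by rw [← sq_abs]; exact pow_le_pow_left₀ (abs_nonneg b) hb 2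
    calc _ ≤ (a + R) ^ m * 1 * (1 + R ^ 2) := by gcongr
      _ = _ := by ring

end Characteristics

/-! ### The inversion integrals: convergence and differentiation -/

variable {T : Characteristics}

lemma add_mul_I_re_pos {a : ℝ} (ha : 0 < a) (b : ℝ) : 0 < (a + b * Complex.I : ℂ).re := by
  simpa using ha

lemma add_mul_I_ne_zero {a : ℝ} (ha : 0 < a) (b : ℝ) : (a + b * Complex.I : ℂ) ≠ 0 := fun h => by
  have := add_mul_I_re_pos ha b
  rw [h] at this
  simp at this

/-- The factor `z` of `Φ†` cancels the denominator, which leaves only natural powers of `z`. -/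
lemma bromwichIntegrand_eq (T : Characteristics) (k l : ℕ) {a : ℝ} (ha : 0 < a) (x t b : ℝ) :
    bromwichIntegrand T k l a x t b =
      T.tailLaplace (a + b * Complex.I) * T.Phi (a + b * Complex.I) ^ k *
        (a + b * Complex.I) ^ l *
        Complex.exp (t * (a + b * Complex.I) - x * T.Phi (a + b * Complex.I)) := by
  have h0 := add_mul_I_ne_zero ha b
  simp only [bromwichIntegrand]
  rw [T.PhiDag_eq_tailLaplace (add_mul_I_re_pos ha b), zpow_sub₀ h0, zpow_one, zpow_natCast]
  field_simp

lemma continuous_Phi_line (T : Characteristics) {a : ℝ} (ha : 0 < a) :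
    Continuous fun b : ℝ => T.Phi (a + b * Complex.I) :=
  continuous_iff_continuousAt.2 fun b =>
    ContinuousAt.comp (f := fun b : ℝ => (a + b * Complex.I : ℂ))
      (T.differentiableAt_Phi (add_mul_I_re_pos ha b)).continuousAt
      (Continuous.continuousAt (by fun_prop))

lemma continuous_tailLaplace_line (T : Characteristics) {a : ℝ} (ha : 0 < a) :
    Continuous fun b : ℝ => T.tailLaplace (a + b * Complex.I) :=
  continuous_iff_continuousAt.2 fun b =>
    ContinuousAt.comp (f := fun b : ℝ => (a + b * Complex.I : ℂ))
      (T.differentiableAt_tailLaplace (add_mul_I_re_pos ha b)).continuousAt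
      (Continuous.continuousAt (by fun_prop))

lemma continuous_bromwichIntegrand (T : Characteristics) (k l : ℕ) {a : ℝ} (ha : 0 < a)
    (x t : ℝ) : Continuous (bromwichIntegrand T k l a x t) := by
  have h1 := continuous_Phi_line T ha
  have h2 := continuous_tailLaplace_line T ha
  rw [funext (bromwichIntegrand_eq T k l ha x t)]
  fun_prop

lemma norm_cexp_sub_mul_Phi (T : Characteristics) (a x t b : ℝ) :
    ‖Complex.exp (t * (a + b * Complex.I) - x * T.Phi (a + b * Complex.I))‖ =
      Real.exp (t * a) * Real.exp (-x * (T.Phi (a + b * Complex.I)).re) := by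
  rw [Complex.norm_exp, ← Real.exp_add]
  simp [sub_eq_add_neg]

lemma norm_bromwichIntegrand (T : Characteristics) (k l : ℕ) {a : ℝ} (ha : 0 < a) (x t b : ℝ) :
    ‖bromwichIntegrand T k l a x t b‖ =
      ‖T.tailLaplace (a + b * Complex.I) * T.Phi (a + b * Complex.I) ^ k *
        (a + b * Complex.I) ^ l‖ *
      (Real.exp (t * a) * Real.exp (-x * (T.Phi (a + b * Complex.I)).re)) := by
  rw [bromwichIntegrand_eq T k l ha, norm_mul, norm_cexp_sub_mul_Phi]

/-- Absolute convergence of the inversion integrals. -/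
theorem integrable_bromwichIntegrand {L : ℝ≥0∞} (h : T.GrowthCondition L) {n k l : ℕ}
    (hkl : k + l ≤ n) {x : ℝ} (hx : threshold n L < x) {a : ℝ} (ha : 0 < a) (t : ℝ) :
    Integrable (bromwichIntegrand T k l a x t) := by
  obtain ⟨C, hC⟩ := h.exists_pow_mul_exp_le hx ha hkl
  obtain ⟨D, hD0, hD⟩ := T.exists_norm_Phi_le ha
  set G := ∫ u : ℝ, Real.exp (-a * u) ∂T.tailMeasure with hG
  have hG0 : 0 ≤ G := integral_nonneg fun u => (Real.exp_pos _).le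
  refine (integrable_inv_one_add_sq.const_mul (G * D ^ k * Real.exp (t * a) * C)).mono'
    (continuous_bromwichIntegrand T k l ha x t).aestronglyMeasurable (.of_forall fun b => ?_)
  rw [norm_bromwichIntegrand T k l ha]
  set z : ℂ := a + b * Complex.I with hz
  have hre : z.re = a := by simp [hz]
  have h1 : ‖T.tailLaplace z‖ ≤ G := by rw [hG, ← hre]; exact T.norm_tailLaplace_le z
  have h2 := hD z hre
  rw [norm_mul, norm_mul, norm_pow, norm_pow]
  calc _ ≤ G * (D * ‖z‖) ^ k * ‖z‖ ^ l * (Real.exp (t * a) * Real.exp (-x * (T.Phi z).re)) := by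
        gcongr
    _ = G * D ^ k * Real.exp (t * a) * (‖z‖ ^ (k + l) * Real.exp (-x * (T.Phi z).re)) := by
        rw [mul_pow, pow_add]; ring
    _ ≤ G * D ^ k * Real.exp (t * a) * (C * (1 + b ^ 2)⁻¹) := by
        have := hC b
        gcongr
    _ = _ := by ring

lemma integrable_cexp_neg_mul_Phi {L : ℝ≥0∞} (h : T.GrowthCondition L) {n : ℕ} {x : ℝ}
    (hx : threshold n L < x) {a : ℝ} (ha : 0 < a) :
    Integrable fun b : ℝ => Complex.exp (-x * T.Phi (a + b * Complex.I)) := by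
  obtain ⟨C, hC⟩ := h.exists_pow_mul_exp_le hx ha n.zero_le
  have hcont := continuous_Phi_line T ha
  refine (integrable_inv_one_add_sq.const_mul C).mono'
    (Continuous.aestronglyMeasurable (by fun_prop)) (.of_forall fun b => ?_)
  have := hC b
  rw [pow_zero, one_mul] at this
  rw [Complex.norm_exp]
  simpa using this

lemma hasDerivAt_integral_bromwichIntegrand_space {L : ℝ≥0∞} (h : T.GrowthCondition L)
    {n k l : ℕ} (hkl : k + l + 1 ≤ n) {x : ℝ} (hx : threshold n L < x) {a : ℝ} (ha : 0 < a)
    (t : ℝ) :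
    HasDerivAt (fun y => ∫ b, bromwichIntegrand T k l a y t b)
      (-∫ b, bromwichIntegrand T (k + 1) l a x t b) x := by
  -- As `Re Φ ≥ 0`, the norm of the integrand is non-increasing in `x`: its value at a point `x₁ <
  -- x` still beyond the threshold dominates on `(x₁, ∞)`.
  obtain ⟨x₁, hx₁, hx₁x⟩ := exists_between hx
  rw [← integral_neg]
  refine (hasDerivAt_integral_of_dominated_loc_of_deriv_le
    (F' := fun y b => -bromwichIntegrand T (k + 1) l a y t b)
    (bound := fun b => ‖bromwichIntegrand T (k + 1) l a x₁ t b‖) (Ioi_mem_nhds hx₁x)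
    (.of_forall fun y => (continuous_bromwichIntegrand T k l ha y t).aestronglyMeasurable)
    (integrable_bromwichIntegrand h (by omega) hx ha t)
    (continuous_bromwichIntegrand T (k + 1) l ha x t).neg.aestronglyMeasurable
    (.of_forall fun b y hy => ?_)
    (integrable_bromwichIntegrand h (by omega) hx₁ ha t).norm
    (.of_forall fun b y _ => ?_)).2
  · have hΦ := T.re_Phi_nonneg (add_mul_I_re_pos ha b).le
    have hy' : x₁ < y := hy
    rw [norm_neg, norm_bromwichIntegrand T _ _ ha, norm_bromwichIntegrand T _ _ ha]
    gcongr
  · simp_rw [bromwichIntegrand_eq T _ _ ha]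
    have h1 : HasDerivAt (fun y : ℝ => (y : ℂ) * T.Phi (a + b * Complex.I))
        (T.Phi (a + b * Complex.I)) y := by
      simpa using (Complex.ofRealCLM.hasDerivAt (x := y)).mul_const (T.Phi (a + b * Complex.I))
    have h2 := ((h1.const_sub (t * (a + b * Complex.I))).cexp).const_mul
      (T.tailLaplace (a + b * Complex.I) * T.Phi (a + b * Complex.I) ^ k * (a + b * Complex.I) ^ l)
    refine h2.congr_deriv ?_
    ring

lemma hasDerivAt_integral_bromwichIntegrand_time {L : ℝ≥0∞} (h : T.GrowthCondition L)
    {n k l : ℕ} (hkl : k + l + 1 ≤ n) {x : ℝ} (hx : threshold n L < x) {a : ℝ} (ha : 0 < a)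
    (t : ℝ) :
    HasDerivAt (fun s => ∫ b, bromwichIntegrand T k l a x s b)
      (∫ b, bromwichIntegrand T k (l + 1) a x t b) t := by
  -- The norm depends on `t` only through `e^{ta}`, so its value at `t + 1` dominates on `(-∞, t +
  -- 1)`.
  refine (hasDerivAt_integral_of_dominated_loc_of_deriv_le
    (F' := fun s b => bromwichIntegrand T k (l + 1) a x s b)
    (bound := fun b => ‖bromwichIntegrand T k (l + 1) a x (t + 1) b‖)
    (Iio_mem_nhds (lt_add_one t))
    (.of_forall fun s => (continuous_bromwichIntegrand T k l ha x s).aestronglyMeasurable)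
    (integrable_bromwichIntegrand h (by omega) hx ha t)
    (continuous_bromwichIntegrand T k (l + 1) ha x t).aestronglyMeasurable
    (.of_forall fun b s hs => ?_)
    (integrable_bromwichIntegrand h (by omega) hx ha (t + 1)).norm
    (.of_forall fun b s _ => ?_)).2
  · have hs' : s < t + 1 := hs
    rw [norm_bromwichIntegrand T _ _ ha, norm_bromwichIntegrand T _ _ ha]
    gcongr
  · simp_rw [bromwichIntegrand_eq T _ _ ha]
    have h1 : HasDerivAt (fun s : ℝ => (s : ℂ) * (a + b * Complex.I)) (a + b * Complex.I) s := by
      simpa using (Complex.ofRealCLM.hasDerivAt (x := s)).mul_const (a + b * Complex.I)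
    have h2 := ((h1.sub_const (x * T.Phi (a + b * Complex.I))).cexp).const_mul
      (T.tailLaplace (a + b * Complex.I) * T.Phi (a + b * Complex.I) ^ k * (a + b * Complex.I) ^ l)
    refine h2.congr_deriv ?_
    ring

/-- Passes from the complex inversion integrals to the real function `f_Φ`: the real part is
differentiable, and uniqueness of derivatives shows that `G'` is real. -/
lemma hasDerivAt_of_eventually_ofReal_eq {g : ℝ → ℝ} {G : ℝ → ℂ} {G' : ℂ} {x : ℝ}
    (hG : HasDerivAt G G' x) (hg : ∀ᶠ y in 𝓝 x, (g y : ℂ) = G y) :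
    DifferentiableAt ℝ g x ∧ ((deriv g x : ℝ) : ℂ) = G' := by
  have h1 : HasDerivAt (fun y => (g y : ℂ)) G' x := hG.congr_of_eventuallyEq hg
  have h2 : HasDerivAt g G'.re x := by
    simpa [Function.comp_def] using (Complex.reCLM.hasFDerivAt.comp_hasDerivAt x h1)
  exact ⟨h2.differentiableAt, by rw [h2.deriv]; exact h2.ofReal_comp.unique h1⟩

/-- If a real function agrees on an open set with the first member of a family `Q k l` closed under
partial differentiation, then its mixed partial derivatives exist and are the `Q k l`. -/
lemma mixedPartial_eq_of_hasDerivAt {f : ℝ → ℝ → ℝ} {U : Set (ℝ × ℝ)} (hU : IsOpen U) {n : ℕ}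
    {Q : ℕ → ℕ → ℝ → ℝ → ℂ} (hf : ∀ x t, (x, t) ∈ U → (f x t : ℂ) = Q 0 0 x t)
    (hspace : ∀ k l x t, k + l + 1 ≤ n → (x, t) ∈ U →
      HasDerivAt (fun y => Q k l y t) (Q (k + 1) l x t) x)
    (htime : ∀ k l x t, k + l + 1 ≤ n → (x, t) ∈ U →
      HasDerivAt (fun s => Q k l x s) (Q k (l + 1) x t) t) (w : List Coord) :
    w.count .space + w.count .time ≤ n → ∀ x t, (x, t) ∈ U → MixedPartialExistsAt w f x t ∧
      (mixedPartial w f x t : ℂ) = Q (w.count .space) (w.count .time) x t := by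
  induction w with
  | nil => exact fun _ x t hxt => ⟨trivial, hf x t hxt⟩
  | cons c w ih =>
    intro hw x t hxt
    -- Openness makes the induction hypothesis an identity near the point, which can be
    -- differentiated.
    have hUn : ∀ᶠ p in 𝓝 (x, t), p ∈ U := hU.mem_nhds hxt
    cases c with
    | space =>
      rw [List.count_cons_self, List.count_cons_of_ne (by decide)] at hw ⊢
      have ih' := ih (by omega)
      have hy : ∀ᶠ y in 𝓝 x, (y, t) ∈ U :=
        (Continuous.tendsto (f := fun y : ℝ => (y, t)) (by fun_prop) x).eventually hUn
      have h := hasDerivAt_of_eventually_ofReal_eq (g := fun y => mixedPartial w f y t)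
        (hspace (w.count .space) (w.count .time) x t (by omega) hxt)
        (hy.mono fun y hy => (ih' y t hy).2)
      exact ⟨⟨hUn.mono fun p hp => (ih' p.1 p.2 hp).1, h.1⟩, h.2⟩
    | time =>
      rw [List.count_cons_self, List.count_cons_of_ne (by decide)] at hw ⊢
      have ih' := ih (by omega)
      have hs : ∀ᶠ s in 𝓝 t, (x, s) ∈ U :=
        (Continuous.tendsto (f := fun s : ℝ => (x, s)) (by fun_prop) t).eventually hUn
      have h := hasDerivAt_of_eventually_ofReal_eq (g := fun s => mixedPartial w f x s)
        (htime (w.count .space) (w.count .time) x t (by omega) hxt)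
        (hs.mono fun s hs => (ih' x s hs).2)
      exact ⟨⟨hUn.mono fun p hp => (ih' p.1 p.2 hp).1, h.1⟩, h.2⟩

/-! ### The law of the subordinator before killing -/

/-- A monotone additive function on `[0, ∞)` is linear. -/
lemma eq_mul_of_monotone_of_add {h : ℝ≥0 → ℝ} (hm : Monotone h)
    (hadd : ∀ x y, h (x + y) = h x + h y) (x : ℝ≥0) : h x = x * h 1 := by
  have h0 : h 0 = 0 := by simpa using hadd 0 0
  have hnat : ∀ (n : ℕ) (y : ℝ≥0), h (n * y) = n * h y := by
    intro n y
    induction n with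
    | zero => simpa using h0
    | succ n ih => push_cast; rw [add_mul, one_mul, hadd, ih]; ring
  have h1 : 0 ≤ h 1 := h0 ▸ hm zero_le_one
  -- Both `h (n x)` and `n x h 1` lie between `⌊n x⌋ h 1` and `(⌊n x⌋ + 1) h 1`; letting `n` grow
  -- forces equality.
  have hb : ∀ n : ℕ, n * |h x - x * h 1| ≤ h 1 := by
    intro n
    have e : (n : ℝ) * |h x - x * h 1| = |h (n * x) - n * x * h 1| := by
      rw [hnat, ← Nat.abs_cast n, ← abs_mul, Nat.abs_cast]; ring_nf
    rw [e]
    have f1 : ((⌊(n * x : ℝ≥0)⌋₊ : ℝ≥0)) ≤ n * x := Nat.floor_le zero_le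
    have f2 : n * x ≤ ((⌊(n * x : ℝ≥0)⌋₊ : ℝ≥0)) + 1 := (Nat.lt_floor_add_one _).le
    have g1 := hm f1
    have g2 := hm f2
    have g3 := hnat ⌊(n * x : ℝ≥0)⌋₊ 1
    rw [mul_one] at g3
    rw [hadd] at g2
    rw [g3] at g1 g2
    have f1' : ((⌊(n * x : ℝ≥0)⌋₊ : ℝ)) ≤ n * x := by exact_mod_cast f1
    have f2' : (n * x : ℝ) ≤ (⌊(n * x : ℝ≥0)⌋₊ : ℝ) + 1 := by exact_mod_cast f2
    rw [abs_le]
    constructor <;> nlinarith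
  by_contra hne
  have hpos : 0 < |h x - x * h 1| := abs_pos.2 (sub_ne_zero.2 hne)
  obtain ⟨n, hn⟩ := exists_nat_gt (h 1 / |h x - x * h 1|)
  have := hb n
  rw [div_lt_iff₀ hpos] at hn
  linarith

section Processes

variable {Ω : Type*} [MeasurableSpace Ω] {P : Measure Ω} {S : ℝ≥0 → Ω → ℝ}

lemma IsSubordinator.ae_nonneg (hS : IsSubordinator S P) (x : ℝ≥0) : ∀ᵐ ω ∂P, 0 ≤ S x ω := by
  filter_upwards [hS.zero, hS.mono] with ω h0 hm
  rw [← h0]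
  exact hm zero_le

lemma IsSubordinator.integral_exp_add (hS : IsSubordinator S P) (c : ℝ) (x y : ℝ≥0) :
    ∫ ω, Real.exp (-c * S (x + y) ω) ∂P =
      (∫ ω, Real.exp (-c * S x ω) ∂P) * ∫ ω, Real.exp (-c * S y ω) ∂P := by
  have hm : Measurable fun s : ℝ => Real.exp (-c * s) := by fun_prop
  have hind : IndepFun (S x) (S (x + y) - S x) P :=
    hS.indep.indepFun_eval_sub zero_le le_self_add hS.zero
  have h1 := (hind.comp hm hm).integral_mul_eq_mul_integral
    (hm.comp (hS.measurable x)).aestronglyMeasurable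
    (hm.comp ((hS.measurable (x + y)).sub (hS.measurable x))).aestronglyMeasurable
  have h2 : ∫ ω, Real.exp (-c * (S (x + y) ω - S x ω)) ∂P = ∫ ω, Real.exp (-c * S y ω) ∂P :=
    ((hS.stationary x y).comp hm).integral_eq
  rw [← h2]
  refine Eq.trans ?_ h1
  refine integral_congr_ae (.of_forall fun ω => ?_)
  simp only [Pi.mul_apply, Function.comp_apply, Pi.sub_apply]
  rw [← Real.exp_add]
  ring_nf

/-- The law of `S x` on the event that the lifetime `e` exceeds `x`. -/
noncomputable def aliveLaw (S : ℝ≥0 → Ω → ℝ) (e : Ω → ℝ≥0∞) (P : Measure Ω) (x : ℝ≥0) :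
    Measure ℝ := (P.restrict {ω | (x : ℝ≥0∞) < e ω}).map (S x)

variable {e : Ω → ℝ≥0∞} {q : ℝ}

lemma measurableSet_alive (he : Measurable e) (x : ℝ≥0) :
    MeasurableSet {ω | (x : ℝ≥0∞) < e ω} := measurableSet_lt measurable_const he

lemma setIntegral_alive_exp (hS : IsSubordinator S P) (he : Measurable e)
    (hq : ∀ s : ℝ≥0, P {ω | (s : ℝ≥0∞) < e ω} = ENNReal.ofReal (Real.exp (-q * s)))
    (hind : IndepFun (fun ω (x : ℝ≥0) => S x ω) e P) (c : ℝ) (x : ℝ≥0) :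
    ∫ ω in {ω | (x : ℝ≥0∞) < e ω}, Real.exp (-c * S x ω) ∂P =
      Real.exp (-q * x) * ∫ ω, Real.exp (-c * S x ω) ∂P := by
  have hm : Measurable fun s : ℝ≥0 → ℝ => Real.exp (-c * s x) := by fun_prop
  have hi : Measurable ((Ioi (x : ℝ≥0∞)).indicator fun _ => (1 : ℝ)) :=
    measurable_const.indicator measurableSet_Ioi
  have h1 := (hind.comp hm hi).integral_mul_eq_mul_integral
    (hm.comp (measurable_pi_iff.2 hS.measurable)).aestronglyMeasurable
    (hi.comp he).aestronglyMeasurable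
  have h2 : ∫ ω, ((Ioi (x : ℝ≥0∞)).indicator (fun _ => (1 : ℝ)) ∘ e) ω ∂P = Real.exp (-q * x) := by
    have : ((Ioi (x : ℝ≥0∞)).indicator (fun _ => (1 : ℝ)) ∘ e)
        = {ω | (x : ℝ≥0∞) < e ω}.indicator 1 := by
      ext ω; by_cases h : (x : ℝ≥0∞) < e ω <;> simp [h]
    rw [this, integral_indicator_one (measurableSet_alive he x), Measure.real, hq,
      ENNReal.toReal_ofReal (Real.exp_pos _).le]
  rw [h2] at h1
  rw [mul_comm, ← integral_indicator (measurableSet_alive he x)]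
  refine Eq.trans ?_ h1
  refine integral_congr_ae (.of_forall fun ω => ?_)
  by_cases h : (x : ℝ≥0∞) < e ω <;> simp [h]

lemma ae_aliveLaw_nonneg (hS : IsSubordinator S P) (x : ℝ≥0) :
    ∀ᵐ s ∂(aliveLaw S e P x), 0 ≤ s := by
  rw [aliveLaw, ae_map_iff (hS.measurable x).aemeasurable measurableSet_Ici]
  exact ae_restrict_of_ae (hS.ae_nonneg x)

variable [IsProbabilityMeasure P]

lemma IsSubordinator.integrable_exp (hS : IsSubordinator S P) {c : ℝ} (hc : 0 ≤ c) (x : ℝ≥0) :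
    Integrable (fun ω => Real.exp (-c * S x ω)) P := by
  have := hS.measurable x
  refine (integrable_const (1 : ℝ)).mono' (by fun_prop) ?_
  filter_upwards [hS.ae_nonneg x] with ω hω
  rw [Real.norm_of_nonneg (Real.exp_pos _).le, Real.exp_le_one_iff]
  nlinarith

/-- Independent stationary increments make the transform multiplicative in `x`, and monotone paths
make it non-increasing, so minus its logarithm is additive and monotone, hence linear. -/
lemma IsSubordinator.integral_exp_eq (hS : IsSubordinator S P) {c : ℝ} (hc : 0 ≤ c) (x : ℝ≥0) :
    ∫ ω, Real.exp (-c * S x ω) ∂P =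
      Real.exp (x * Real.log (∫ ω, Real.exp (-c * S 1 ω) ∂P)) := by
  set g : ℝ≥0 → ℝ := fun x => ∫ ω, Real.exp (-c * S x ω) ∂P with hg
  have hpos : ∀ x, 0 < g x := fun x => integral_exp_pos (hS.integrable_exp hc x)
  have hmono : Monotone fun x => -Real.log (g x) := by
    intro x y hxy
    refine neg_le_neg (Real.log_le_log (hpos y) ?_)
    refine integral_mono_ae (hS.integrable_exp hc y) (hS.integrable_exp hc x) ?_
    filter_upwards [hS.mono] with ω hω
    have := hω hxy
    simp only [Real.exp_le_exp]
    nlinarith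
  have hadd : ∀ x y, -Real.log (g (x + y)) = -Real.log (g x) + -Real.log (g y) := by
    intro x y
    rw [show g (x + y) = g x * g y from hS.integral_exp_add c x y,
      Real.log_mul (hpos x).ne' (hpos y).ne']
    ring
  have := eq_mul_of_monotone_of_add hmono hadd x
  change g x = Real.exp (x * Real.log (g 1))
  rw [show (x : ℝ) * Real.log (g 1) = Real.log (g x) by linarith, Real.exp_log (hpos x)]

instance isFiniteMeasure_aliveLaw (x : ℝ≥0) :
    IsFiniteMeasure (aliveLaw S e P x) := by
  unfold aliveLaw; infer_instance

lemma Characteristics.Phi_ofReal (T : Characteristics) (c : ℝ) :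
    T.Phi c = ((T.Phi c).re : ℂ) := by
  have : T.Phi c = ((T.q + T.drift * c + ∫ y : ℝ, (1 - Real.exp (-c * y)) ∂T.levy : ℝ) : ℂ) := by
    rw [T.Phi_eq]
    push_cast
    rw [← integral_complex_ofReal]
    push_cast
    rfl
  rw [this, Complex.ofReal_re]

/-- The Laplace exponent is prescribed at time 1 only. With `g = E[e^{-cS(1)}]` it says `e^{-q} g =
e^{-Φ(c)}`, so `e^{-qx} g^x = e^{-xΦ(c)}`. Real `c` keeps the logarithm unambiguous. -/
lemma integral_exp_aliveLaw_ofReal {T : Characteristics} {σ : ℝ≥0 → Ω → ℝ≥0∞}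
    (hS : IsSubordinator S P) (he : Measurable e)
    (hq : ∀ s : ℝ≥0, P {ω | (s : ℝ≥0∞) < e ω} = ENNReal.ofReal (Real.exp (-T.q * s)))
    (hind : IndepFun (fun ω (x : ℝ≥0) => S x ω) e P)
    (hσ : ∀ (x : ℝ≥0) (ω : Ω),
      ((x : ℝ≥0∞) < e ω → σ x ω = ENNReal.ofReal (S x ω)) ∧ (e ω ≤ x → σ x ω = ⊤))
    (hΦ : HasLaplaceExponent σ P T.Phi) {c : ℝ} (hc : 0 ≤ c) (x : ℝ≥0) :
    ∫ s, Real.exp (-c * s) ∂(aliveLaw S e P x) = Real.exp (-x * (T.Phi c).re) := by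
  rw [aliveLaw, integral_map (hS.measurable x).aemeasurable (by fun_prop),
    setIntegral_alive_exp hS he hq hind, hS.integral_exp_eq hc]
  set g := ∫ ω, Real.exp (-c * S 1 ω) ∂P with hg
  have hg0 : 0 < g := integral_exp_pos (hS.integrable_exp hc 1)
  have h1 := hΦ c (by simpa using hc)
  have hset : {ω | σ 1 ω ≠ ⊤} = {ω | ((1 : ℝ≥0) : ℝ≥0∞) < e ω} := by
    ext ω
    by_cases h : ((1 : ℝ≥0) : ℝ≥0∞) < e ω
    · exact iff_of_true (by rw [mem_ofPred_eq, (hσ 1 ω).1 h]; exact ENNReal.ofReal_ne_top) h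
    · exact iff_of_false (not_not.2 ((hσ 1 ω).2 (not_lt.1 h))) h
  have h2 : ∫ ω in {ω | σ 1 ω ≠ ⊤}, Complex.exp (-c * ((σ 1 ω).toReal : ℂ)) ∂P
      = ((∫ ω in {ω | ((1 : ℝ≥0) : ℝ≥0∞) < e ω}, Real.exp (-c * S 1 ω) ∂P : ℝ) : ℂ) := by
    rw [hset, ← integral_complex_ofReal]
    refine integral_congr_ae ?_
    filter_upwards [ae_restrict_mem (measurableSet_alive he 1),
      ae_restrict_of_ae (hS.ae_nonneg 1)] with ω hω h0
    rw [(hσ 1 ω).1 hω, ENNReal.toReal_ofReal h0]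
    push_cast; rfl
  rw [h2, setIntegral_alive_exp hS he hq hind, T.Phi_ofReal, ← Complex.ofReal_neg,
    ← Complex.ofReal_exp, Complex.ofReal_inj, ← hg] at h1
  have h3 : Real.log g = T.q - (T.Phi c).re := by
    have := congrArg Real.log h1
    rw [Real.log_mul (Real.exp_pos _).ne' hg0.ne', Real.log_exp, Real.log_exp] at this
    push_cast at this
    linarith
  rw [h3, ← Real.exp_add]
  ring_nf

end Processes

/-! ### From Laplace transforms to densities -/

/-- Two functions that are holomorphic on the right half-plane and agree on the positive reals
agree. -/
lemma eqOn_re_pos_of_eq_ofReal {f g : ℂ → ℂ} (hf : ∀ z : ℂ, 0 < z.re → DifferentiableAt ℂ f z)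
    (hg : ∀ z : ℂ, 0 < z.re → DifferentiableAt ℂ g z) (h : ∀ c : ℝ, 0 < c → f c = g c)
    {z : ℂ} (hz : 0 < z.re) : f z = g z := by
  have ho : IsOpen {z : ℂ | 0 < z.re} := isOpen_lt continuous_const Complex.continuous_re
  have hfa : AnalyticOnNhd ℂ f {z : ℂ | 0 < z.re} :=
    DifferentiableOn.analyticOnNhd (fun w hw => (hf w hw).differentiableWithinAt) ho
  have hga : AnalyticOnNhd ℂ g {z : ℂ | 0 < z.re} :=
    DifferentiableOn.analyticOnNhd (fun w hw => (hg w hw).differentiableWithinAt) ho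
  have hc : IsPreconnected {z : ℂ | 0 < z.re} := (convex_halfSpace_re_gt 0).isPreconnected
  have h1 : (1 : ℂ) ∈ {z : ℂ | 0 < z.re} := by simp
  refine hfa.eqOn_of_preconnected_of_frequently_eq hga hc h1 ?_ hz
  have ht : Tendsto (fun c : ℝ => (c : ℂ)) (𝓝[≠] 1) (𝓝[≠] 1) := by
    refine tendsto_nhdsWithin_iff.2 ⟨?_, ?_⟩
    · have := Complex.continuous_ofReal.tendsto (1 : ℝ)
      rw [Complex.ofReal_one] at this
      exact this.mono_left nhdsWithin_le_nhds
    · filter_upwards [self_mem_nhdsWithin] with c hc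
      simpa using hc
  refine ht.frequently (Eventually.frequently ?_)
  filter_upwards [nhdsWithin_le_nhds (lt_mem_nhds (zero_lt_one' ℝ))] with c hc using h c hc

section Laplace

variable {m : Measure ℝ} [IsFiniteMeasure m]

lemma integrable_exp_of_ae_nonneg (hm : ∀ᵐ s ∂m, 0 ≤ s) {c : ℝ} (hc : 0 ≤ c) :
    Integrable (fun s => Real.exp (-c * s)) m := by
  refine (integrable_const (1 : ℝ)).mono' (by fun_prop) ?_
  filter_upwards [hm] with s hs
  rw [Real.norm_of_nonneg (Real.exp_pos _).le, Real.exp_le_one_iff]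
  nlinarith

lemma differentiableAt_laplace_of_ae_nonneg (hm : ∀ᵐ s ∂m, 0 ≤ s) {z : ℂ} (hz : 0 < z.re) :
    DifferentiableAt ℂ (fun z : ℂ => ∫ s : ℝ, Complex.exp (-z * s) ∂m) z := by
  have e : (fun z : ℂ => ∫ s : ℝ, Complex.exp (-z * s) ∂m) = fun z => complexMGF id m (-z) := rfl
  have hsub : Iio (0 : ℝ) ⊆ integrableExpSet id m := by
    intro s hs
    have := integrable_exp_of_ae_nonneg hm (c := -s) (by simpa using le_of_lt hs)
    simpa [integrableExpSet] using this
  have hint : (-z).re ∈ interior (integrableExpSet id m) :=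
    interior_maximal hsub isOpen_Iio (by simpa using hz)
  rw [e]
  exact (hasDerivAt_complexMGF hint).differentiableAt.comp z differentiableAt_id.neg

/-- Analytic continuation from the positive reals avoids choosing a branch of the logarithm. -/
lemma laplace_eq_of_ofReal {T : Characteristics} (hm : ∀ᵐ s ∂m, 0 ≤ s) {x : ℝ}
    (h : ∀ c : ℝ, 0 < c → ∫ s, Real.exp (-c * s) ∂m = Real.exp (-x * (T.Phi c).re))
    {z : ℂ} (hz : 0 < z.re) :
    ∫ s : ℝ, Complex.exp (-z * s) ∂m = Complex.exp (-x * T.Phi z) := by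
  refine eqOn_re_pos_of_eq_ofReal (f := fun z => ∫ s : ℝ, Complex.exp (-z * s) ∂m)
    (g := fun z => Complex.exp (-x * T.Phi z))
    (fun w hw => differentiableAt_laplace_of_ae_nonneg hm hw)
    (fun w hw => ((T.differentiableAt_Phi hw).const_mul _).cexp) (fun c hc => ?_) hz
  have := congrArg Complex.ofReal (h c hc)
  rw [← integral_complex_ofReal] at this
  push_cast at this
  rw [← T.Phi_ofReal] at this
  exact this

end Laplace

/-- The endpoint `u = 0`, where `ν̄` may be infinite, is Lebesgue-null and can be dropped. -/
lemma lintegral_Iic_comp_sub {F K : ℝ → ℝ≥0∞} (t : ℝ) :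
    ∫⁻ s in Iic t, F (t - s) * K s = ∫⁻ u in Ioi 0, F u * K (t - u) := by
  rw [← lintegral_indicator measurableSet_Iic, restrict_Ioi_eq_restrict_Ici,
    ← lintegral_indicator measurableSet_Ici,
    ← lintegral_sub_left_eq_self (fun s => (Iic t).indicator (fun s => F (t - s) * K s) s) t]
  congr 1 with u
  by_cases h : 0 ≤ u <;> simp [indicator, h]

section Tilt

variable {T : Characteristics} {m : Measure ℝ} [IsFiniteMeasure m] {a x : ℝ}

/-- The exponentially tilted measure `e^{-as} m(ds)`. -/
noncomputable def expTilt (m : Measure ℝ) (a : ℝ) : Measure ℝ :=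
  m.withDensity fun s => ENNReal.ofReal (Real.exp (-a * s))

lemma isFiniteMeasure_expTilt (hm : ∀ᵐ s ∂m, 0 ≤ s) (ha : 0 < a) :
    IsFiniteMeasure (expTilt m a) := by
  refine isFiniteMeasure_withDensity (ne_of_lt ?_)
  have := (integrable_exp_of_ae_nonneg hm ha.le).2
  rwa [hasFiniteIntegral_iff_ofReal (.of_forall fun s => (Real.exp_pos _).le)] at this

omit [IsFiniteMeasure m] in
lemma expTilt_withDensity_exp (m : Measure ℝ) (a : ℝ) :
    (expTilt m a).withDensity (fun s => ENNReal.ofReal (Real.exp (a * s))) = m := by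
  unfold expTilt
  rw [← withDensity_mul _ (by fun_prop) (by fun_prop)]
  have : ((fun s => ENNReal.ofReal (Real.exp (-a * s))) *
      fun s => ENNReal.ofReal (Real.exp (a * s))) = 1 := by
    ext s
    rw [Pi.mul_apply, ← ENNReal.ofReal_mul (Real.exp_pos _).le, ← Real.exp_add]
    simp
  rw [this, withDensity_one]

lemma charFun_expTilt (hm : ∀ᵐ s ∂m, 0 ≤ s) (ha : 0 < a)
    (h : ∀ c : ℝ, 0 < c → ∫ s, Real.exp (-c * s) ∂m = Real.exp (-x * (T.Phi c).re)) (t : ℝ) :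
    charFun (expTilt m a) t = Complex.exp (-x * T.Phi (a + (-t : ℝ) * Complex.I)) := by
  rw [← laplace_eq_of_ofReal hm h (add_mul_I_re_pos ha (-t)), charFun_apply_real, expTilt,
    integral_withDensity_eq_integral_toReal_smul (by fun_prop)
      (.of_forall fun s => ENNReal.ofReal_lt_top)]
  congr 1 with s
  rw [ENNReal.toReal_ofReal (Real.exp_pos _).le, Complex.real_smul]
  push_cast
  rw [← Complex.exp_add]
  ring_nf

end Tilt

/-- The density of a measure with Laplace transform `e^{-xΦ}`, given by the inversion integral along
`Re z = a`. -/
noncomputable def laplaceDensity (T : Characteristics) (a x s : ℝ) : ℂ :=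
  (2 * Real.pi : ℂ)⁻¹ * ∫ b : ℝ, Complex.exp (s * (a + b * Complex.I) - x * T.Phi (a + b * Complex.I))

section Density

variable {T : Characteristics} {m : Measure ℝ} [IsFiniteMeasure m] {a x : ℝ}

/-- Undoing the tilt restores `e^{as}`. The reflection `b ↦ -b` is needed because `charFun` at `t`
is the Laplace transform at `a - it`. -/
lemma exp_mul_inversionDensity_expTilt (hm : ∀ᵐ s ∂m, 0 ≤ s) (ha : 0 < a)
    (h : ∀ c : ℝ, 0 < c → ∫ s, Real.exp (-c * s) ∂m = Real.exp (-x * (T.Phi c).re)) (s : ℝ) :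
    (Real.exp (a * s) : ℂ) * inversionDensity (expTilt m a) s = laplaceDensity T a x s := by
  unfold inversionDensity laplaceDensity
  rw [mul_left_comm, ← integral_const_mul, ← integral_neg_eq_self]
  congr 2 with b
  rw [charFun_expTilt hm ha h, neg_neg]
  push_cast
  rw [← Complex.exp_add, ← Complex.exp_add]
  ring_nf

lemma integrable_charFun_expTilt {L : ℝ≥0∞} (hT : T.GrowthCondition L) {n : ℕ}
    (hx : threshold n L < x) (hm : ∀ᵐ s ∂m, 0 ≤ s) (ha : 0 < a)
    (h : ∀ c : ℝ, 0 < c → ∫ s, Real.exp (-c * s) ∂m = Real.exp (-x * (T.Phi c).re)) :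
    Integrable (charFun (expTilt m a)) := by
  rw [funext (charFun_expTilt hm ha h)]
  exact (integrable_cexp_neg_mul_Phi hT hx ha).comp_neg

/-- A measure with Laplace transform `e^{-xΦ}` has the density given by the inversion integral. -/
lemma exists_density {L : ℝ≥0∞} (hT : T.GrowthCondition L) {n : ℕ}
    (hx : threshold n L < x) (hm : ∀ᵐ s ∂m, 0 ≤ s) (ha : 0 < a)
    (h : ∀ c : ℝ, 0 < c → ∫ s, Real.exp (-c * s) ∂m = Real.exp (-x * (T.Phi c).re)) :
    ∃ p : ℝ → ℝ, Measurable p ∧ (∀ s, 0 ≤ p s) ∧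
      m = volume.withDensity (fun s => ENNReal.ofReal (p s)) ∧
      ∀ᵐ s, (p s : ℂ) = laplaceDensity T a x s := by
  have := isFiniteMeasure_expTilt hm ha
  have hi := integrable_charFun_expTilt hT hx hm ha h
  set m' := expTilt m a with hm'
  have hac := absolutelyContinuous_of_integrable_charFun m' hi
  refine ⟨fun s => Real.exp (a * s) * (m'.rnDeriv volume s).toReal, ?_, fun s => by positivity,
    ?_, ?_⟩
  · exact (by fun_prop : Measurable fun s : ℝ => Real.exp (a * s)).mul
      (Measure.measurable_rnDeriv _ _).ennreal_toReal
  · conv_lhs => rw [← expTilt_withDensity_exp m a, ← hm', ← Measure.withDensity_rnDeriv_eq _ _ hac,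
      ← withDensity_mul _ (Measure.measurable_rnDeriv _ _) (by fun_prop)]
    refine withDensity_congr_ae ?_
    filter_upwards [m'.rnDeriv_lt_top volume] with s hs
    rw [Pi.mul_apply, ENNReal.ofReal_mul (Real.exp_pos _).le, ENNReal.ofReal_toReal hs.ne, mul_comm]
  · filter_upwards [ae_rnDeriv_eq_inversionDensity m' hi] with s hs
    rw [← exp_mul_inversionDensity_expTilt hm ha h, ← hs]
    push_cast; rfl

lemma norm_laplaceDensity_le (T : Characteristics) (a x s : ℝ) :
    ‖laplaceDensity T a x s‖ ≤ Real.exp (a * s) *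
      ((2 * Real.pi)⁻¹ * ∫ b : ℝ, Real.exp (-x * (T.Phi (a + b * Complex.I)).re)) := by
  unfold laplaceDensity
  have h2 : ‖(2 * Real.pi : ℂ)⁻¹‖ = (2 * Real.pi)⁻¹ := by
    rw [norm_inv, norm_mul]
    simp [abs_of_pos Real.pi_pos]
  rw [norm_mul, h2, mul_left_comm, ← integral_const_mul]
  gcongr
  refine (norm_integral_le_integral_norm _).trans (le_of_eq ?_)
  simp_rw [norm_cexp_sub_mul_Phi, mul_comm s a]

lemma integrable_cexp_mul_prod {L : ℝ≥0∞} (hT : T.GrowthCondition L) {n : ℕ}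
    (hx : threshold n L < x) (ha : 0 < a) (t : ℝ) :
    Integrable (fun p : ℝ × ℝ => Complex.exp (((t - p.1 : ℝ) : ℂ) * (a + p.2 * Complex.I) -
      x * T.Phi (a + p.2 * Complex.I))) (T.tailMeasure.prod volume) := by
  have h1 := (T.integrable_exp_tailMeasure ha).const_mul (Real.exp (t * a))
  have h2 := (integrable_cexp_neg_mul_Phi hT hx ha).norm
  have hc := continuous_Phi_line T ha
  have hc' : Continuous fun p : ℝ × ℝ => T.Phi (a + p.2 * Complex.I) := hc.comp continuous_snd
  refine (h1.mul_prod h2).mono' (Continuous.aestronglyMeasurable (by fun_prop))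
    (.of_forall fun p => ?_)
  rw [norm_cexp_sub_mul_Phi]
  have e1 : Real.exp ((t - p.1) * a) = Real.exp (t * a) * Real.exp (-a * p.1) := by
    rw [← Real.exp_add]; ring_nf
  have e2 : ‖Complex.exp (-x * T.Phi (a + p.2 * Complex.I))‖ =
      Real.exp (-x * (T.Phi (a + p.2 * Complex.I)).re) := by
    rw [Complex.norm_exp]; simp
  rw [e1, e2]

/-- The convolution of `ν̄` with the density, as an inversion integral. -/
lemma integral_laplaceDensity_tailMeasure {L : ℝ≥0∞} (hT : T.GrowthCondition L) {n : ℕ}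
    (hx : threshold n L < x) (ha : 0 < a) (t : ℝ) :
    ∫ u, laplaceDensity T a x (t - u) ∂T.tailMeasure =
      (2 * Real.pi : ℂ)⁻¹ * ∫ b, bromwichIntegrand T 0 0 a x t b := by
  unfold laplaceDensity
  rw [integral_const_mul, integral_integral_swap (integrable_cexp_mul_prod hT hx ha t)]
  congr 2 with b
  rw [bromwichIntegrand_eq T 0 0 ha, pow_zero, pow_zero, mul_one, mul_one,
    Characteristics.tailLaplace, ← integral_mul_const]
  congr 1 with u
  rw [← Complex.exp_add]
  push_cast
  ring_nf

/-- The density enters only through its integral against `ν̄(u) du`, which does not see null sets;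
an almost everywhere formula for it thus yields an identity at every `t`. -/
lemma lintegral_tail_eq {L : ℝ≥0∞} (hT : T.GrowthCondition L) {n : ℕ}
    (hx : threshold n L < x) (hm : ∀ᵐ s ∂m, 0 ≤ s)
    (h : ∀ c : ℝ, 0 < c → ∫ s, Real.exp (-c * s) ∂m = Real.exp (-x * (T.Phi c).re)) (ha : 0 < a)
    (t : ℝ) :
    ∫⁻ s in Iic t, T.tail (t - s) ∂m < ⊤ ∧
      ((∫⁻ s in Iic t, T.tail (t - s) ∂m).toReal : ℂ) =
        (2 * Real.pi : ℂ)⁻¹ * ∫ b, bromwichIntegrand T 0 0 a x t b := by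
  obtain ⟨p, hpm, hp0, hmp, hp⟩ := exists_density hT hx hm ha h
  have e1 : ∫⁻ s in Iic t, T.tail (t - s) ∂m
      = ∫⁻ u, ENNReal.ofReal (p (t - u)) ∂T.tailMeasure := by
    have htm : Measurable fun s => T.tail (t - s) := T.measurable_tail.comp (by fun_prop)
    rw [hmp, restrict_withDensity measurableSet_Iic, lintegral_withDensity_eq_lintegral_mul _
      (by fun_prop) htm, Characteristics.tailMeasure, lintegral_withDensity_eq_lintegral_mul _
      T.measurable_tail (by fun_prop)]
    simp only [Pi.mul_apply]
    rw [← lintegral_Iic_comp_sub (F := T.tail) (K := fun s => ENNReal.ofReal (p s))]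
    simp_rw [mul_comm]
  have hp' : ∀ᵐ u ∂T.tailMeasure, (p (t - u) : ℂ) = laplaceDensity T a x (t - u) := by
    have hq : ∀ᵐ u, (p (t - u) : ℂ) = laplaceDensity T a x (t - u) :=
      (Measure.measurePreserving_sub_left volume t).quasiMeasurePreserving.ae hp
    exact (withDensity_absolutelyContinuous _ _).ae_le (ae_restrict_of_ae hq)
  -- The density is at most a constant times `e^{as}`, and `e^{-au}` is integrable against `ν̄(u)
  -- du`.
  have hint : Integrable (fun u => p (t - u)) T.tailMeasure := by
    refine ((T.integrable_exp_tailMeasure ha).const_mul (Real.exp (a * t) *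
      ((2 * Real.pi)⁻¹ * ∫ b : ℝ, Real.exp (-x * (T.Phi (a + b * Complex.I)).re)))).mono'
      (hpm.comp (by fun_prop)).aestronglyMeasurable ?_
    filter_upwards [hp'] with u hu
    rw [← Complex.norm_real, hu]
    refine (norm_laplaceDensity_le T a x (t - u)).trans (le_of_eq ?_)
    rw [mul_sub, sub_eq_add_neg, Real.exp_add, neg_mul]
    ring
  have e2 : ∫⁻ u, ENNReal.ofReal (p (t - u)) ∂T.tailMeasure =
      ENNReal.ofReal (∫ u, p (t - u) ∂T.tailMeasure) :=
    (ofReal_integral_eq_lintegral_ofReal hint (.of_forall fun u => hp0 _)).symm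
  rw [e1, e2]
  refine ⟨ENNReal.ofReal_lt_top, ?_⟩
  rw [ENNReal.toReal_ofReal (integral_nonneg fun u => hp0 _), ← integral_complex_ofReal,
    integral_congr_ae hp', integral_laplaceDensity_tailMeasure hT hx ha]

end Density

/-! ### The density of the killed subordinator and its derivatives -/

section Processes

variable {Ω : Type*} [MeasurableSpace Ω] {P : Measure Ω} {S : ℝ≥0 → Ω → ℝ} {e : Ω → ℝ≥0∞}
  {σ : ℝ≥0 → Ω → ℝ≥0∞}

/-- Killed paths sit at `∞`, outside `[0, t]`, and contribute nothing; on the others `σ(x)` is the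
nonnegative real `S x`, almost surely. -/
lemma densityIntegral_eq_lintegral_aliveLaw (T : Characteristics) (hS : IsSubordinator S P)
    (he : Measurable e)
    (hσ : ∀ (x : ℝ≥0) (ω : Ω),
      ((x : ℝ≥0∞) < e ω → σ x ω = ENNReal.ofReal (S x ω)) ∧ (e ω ≤ x → σ x ω = ⊤))
    (x : ℝ) {t : ℝ} (ht : 0 ≤ t) :
    densityIntegral T σ P x t =
      ∫⁻ s in Iic t, T.tail (t - s) ∂(aliveLaw S e P x.toNNReal) := by
  set y := x.toNNReal with hy
  have hSm := hS.measurable y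
  have hA := measurableSet_alive he y
  have hσm : Measurable (σ y) := by
    classical
    have : σ y = {ω | (y : ℝ≥0∞) < e ω}.piecewise (fun ω => ENNReal.ofReal (S y ω)) fun _ => ⊤ := by
      ext ω
      by_cases h : (y : ℝ≥0∞) < e ω
      · rw [Set.piecewise_eq_of_mem {ω | (y : ℝ≥0∞) < e ω} _ _ h, (hσ y ω).1 h]
      · rw [Set.piecewise_eq_of_notMem {ω | (y : ℝ≥0∞) < e ω} _ _ h, (hσ y ω).2 (not_lt.1 h)]
    rw [this]
    exact Measurable.piecewise hA (by fun_prop) measurable_const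
  have hF1 : Measurable fun s => T.tail (t - s) := T.measurable_tail.comp (by fun_prop)
  have hF2 : Measurable fun s : ℝ≥0∞ => T.tail (t - s.toReal) :=
    T.measurable_tail.comp (by fun_prop)
  rw [densityIntegral, aliveLaw, ← lintegral_indicator measurableSet_Iic,
    ← lintegral_indicator measurableSet_Iic, ← hy,
    lintegral_map (hF2.indicator measurableSet_Iic) hσm,
    lintegral_map (hF1.indicator measurableSet_Iic) hSm, ← lintegral_indicator hA]
  refine lintegral_congr_ae ?_
  filter_upwards [hS.ae_nonneg y] with ω h0
  by_cases h : (y : ℝ≥0∞) < e ω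
  · rw [indicator_of_mem (s := {ω | (y : ℝ≥0∞) < e ω}) h, (hσ y ω).1 h]
    simp only [indicator, mem_Iic, ENNReal.ofReal_le_ofReal_iff ht, ENNReal.toReal_ofReal h0]
  · rw [indicator_of_notMem (s := {ω | (y : ℝ≥0∞) < e ω}) h, (hσ y ω).2 (not_lt.1 h)]
    simp

variable [IsProbabilityMeasure P] {T : Characteristics}

/-- The density integral is finite and is given by the inversion integral of order `0`. -/
theorem densityIntegral_eq_bromwich {L : ℝ≥0∞} (hT : T.GrowthCondition L)
    (hσ : IsKilledSubordinator T.q σ P) (hΦ : HasLaplaceExponent σ P T.Phi) {n : ℕ} {x : ℝ}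
    (hx : threshold n L < x) {t : ℝ} (ht : 0 ≤ t) {a : ℝ} (ha : 0 < a) :
    densityIntegral T σ P x t < ⊤ ∧ ((densityIntegral T σ P x t).toReal : ℂ) =
      (2 * Real.pi : ℂ)⁻¹ * ∫ b, bromwichIntegrand T 0 0 a x t b := by
  obtain ⟨S, e, hS, he, hq, hind, hσ⟩ := hσ
  have hx0 : 0 ≤ x := (threshold_nonneg n L).trans hx.le
  rw [densityIntegral_eq_lintegral_aliveLaw T hS he hσ x ht]
  refine lintegral_tail_eq hT hx (ae_aliveLaw_nonneg hS _) (fun c hc => ?_) ha t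
  rw [integral_exp_aliveLaw_ofReal hS he hq hind hσ hΦ hc.le, Real.coe_toNNReal x hx0]

end Processes

lemma isOpen_domain (T : Characteristics) : IsOpen T.domain :=
  (isOpen_lt continuous_const continuous_snd).inter
    ((isOpen_lt continuous_const continuous_fst).inter
      (isOpen_lt (continuous_const.mul continuous_fst) continuous_snd))

section Processes

variable {Ω : Type*} [MeasurableSpace Ω] {P : Measure Ω} [IsProbabilityMeasure P]
  {σ : ℝ≥0 → Ω → ℝ≥0∞} {T : Characteristics}

/-- Existence of the mixed partial derivatives of the density and their inversion formula. -/
theorem mixedPartial_fPhi {L : ℝ≥0∞} (hT : T.GrowthCondition L)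
    (hσ : IsKilledSubordinator T.q σ P) (hΦ : HasLaplaceExponent σ P T.Phi) {n : ℕ} {x t : ℝ}
    (hxt : (x, t) ∈ T.domain) (hx : threshold n L < x) {a : ℝ} (ha : 0 < a) {w : List Coord}
    (hw : w.count .space + w.count .time ≤ n) :
    MixedPartialExistsAt w (fPhi T σ P) x t ∧
      (mixedPartial w (fPhi T σ P) x t : ℂ) = (-1) ^ w.count .space / (2 * Real.pi) *
        ∫ b, bromwichIntegrand T (w.count .space) (w.count .time) a x t b := by
  -- The threshold condition is open, so the order-zero formula holds near every admissible point.
  have hU : IsOpen (T.domain ∩ {p | threshold n L < p.1}) :=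
    (isOpen_domain T).inter (isOpen_lt continuous_const continuous_fst)
  refine mixedPartial_eq_of_hasDerivAt (n := n) hU
    (Q := fun k l x t => (-1) ^ k / (2 * Real.pi) * ∫ b, bromwichIntegrand T k l a x t b)
    ?_ ?_ ?_ w hw x t ⟨hxt, hx⟩
  · rintro x t ⟨hxt, hx⟩
    rw [fPhi, if_pos hxt, (densityIntegral_eq_bromwich hT hσ hΦ hx hxt.1.le ha).2, pow_zero,
      one_div]
  · rintro k l x t hkl ⟨hxt, hx⟩
    refine ((hasDerivAt_integral_bromwichIntegrand_space hT hkl hx ha t).const_mul _).congr_deriv ?_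
    rw [pow_succ]
    ring
  · rintro k l x t hkl ⟨hxt, hx⟩
    exact (hasDerivAt_integral_bromwichIntegrand_time hT hkl hx ha t).const_mul _

end Processes

end KilledSub

theorem theorem3p1 :
    ∃ x₀ : ℕ → ℝ≥0∞ → ℝ,
      (∀ n L, 0 ≤ x₀ n L) ∧ (∀ n, x₀ n ⊤ = 0) ∧
      ∀ (T : KilledSub.Characteristics) (L : ℝ≥0∞), T.GrowthCondition L →
      ∀ {Ω : Type*} [MeasurableSpace Ω] (P : Measure Ω) [IsProbabilityMeasure P]
        (σ : ℝ≥0 → Ω → ℝ≥0∞),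
        KilledSub.IsKilledSubordinator T.q σ P →
        KilledSub.HasLaplaceExponent σ P T.Phi →
      ∀ n k l : ℕ, k + l ≤ n → ∀ x t : ℝ, (x, t) ∈ T.domain → x₀ n L < x →
        KilledSub.densityIntegral T σ P x t < ⊤ ∧
        (∀ w : List KilledSub.Coord, w.count .space = k → w.count .time = l →
          KilledSub.MixedPartialExistsAt w (KilledSub.fPhi T σ P) x t) ∧
        ∀ a : ℝ, 0 < a →
          Integrable (KilledSub.bromwichIntegrand T k l a x t) ∧
          ∀ w : List KilledSub.Coord, w.count .space = k → w.count .time = l →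
            (KilledSub.mixedPartial w (KilledSub.fPhi T σ P) x t : ℂ) =
              (-1) ^ k / (2 * Real.pi) *
                ∫ b : ℝ, KilledSub.bromwichIntegrand T k l a x t b := by
  refine ⟨KilledSub.threshold, KilledSub.threshold_nonneg, KilledSub.threshold_top, ?_⟩
  intro T L hT Ω _ P _ σ hσ hΦ n k l hkl x t hxt hx
  -- Finiteness and existence do not involve `a`, so they are read off at `a = 1`.
  refine ⟨(KilledSub.densityIntegral_eq_bromwich hT hσ hΦ hx hxt.1.le one_pos).1, ?_, ?_⟩
  · rintro w rfl rfl
    exact (KilledSub.mixedPartial_fPhi hT hσ hΦ hxt hx one_pos hkl).1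
  · refine fun a ha => ⟨KilledSub.integrable_bromwichIntegrand hT hkl hx ha t, ?_⟩
    rintro w rfl rfl
    exact (KilledSub.mixedPartial_fPhi hT hσ hΦ hxt hx ha hkl).2
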